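/- Let $p$ be a prime. Let $B$ be an $\mathbb{F}_p$-algebra and $B'$ a flat $B$-algebra, and suppose that $B$ and $B'$ are perfect (i.e. the Frobenius $x\mapsto x^p$ is bijective). Let $C$ be a semiperfect $B$-algebra (i.e. the Frobenius of $C$ is surjective). Then the canonical ring homomorphism $$A_{\mathrm{cris}}(C)\,\hat\otimes_{W(B)}\,W(B')\longrightarrow A_{\mathrm{cris}}(C\otimes_B B')$$ is an isomorphism. Here $W$ denotes $p$-typical Witt vectors. For a semiperfect $\mathbb{F}_p$-algebra $C$, let $C^\flat$ be the ring of sequences $(c_0,c_1,\ldots)$ in $C$ with $c_{n+1}^p=c_n$ for all $n$; then $A_{\mathrm{cris}}(C)$ is the $p$-adic completion of the PD hull (divided power envelope) of the surjection $W(C^\flat)\twoheadrightarrow C^\flat\twoheadrightarrow C$, the second map being $(c_0,c_1,\ldots)\mapsto c_0$, where divided powers are required to satisfy $\gamma_m(p)=p^m/m!$. Since $B$ is perfect, $B\to C$ lifts uniquely to $B\to C^\flat$, which makes $A_{\mathrm{cris}}(C)$ a $W(B)$-algebra, and $\hat\otimes$ denotes the $p$-adic completion of the tensor product. The canonical map is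 the $p$-adically continuous extension of the map $A_{\mathrm{cris}}(C)\otimes_{W(B)}W(B')\to A_{\mathrm{cris}}(C\otimes_BB')$ induced by $C\to C\otimes_BB'$ and $B'\to C\otimes_BB'$. -/

import Mathlib

open scoped TensorProduct

noncomputable section

/-- `R` is an `𝔽_p`-algebra: a ring in which `p = 0`. The zero ring is allowed (it can occur as a
tensor product), which is why `CharP R p` is not used. -/
class IsFpAlgebra (p : ℕ) (R : Type*) [CommRing R] : Prop where
  natCast_eq_zero : (p : R) = 0

/-- A semiperfect `𝔽_p`-algebra: the Frobenius `x ↦ x ^ p` is surjective. (Perfectness, i.e.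
bijectivity of the Frobenius, is Mathlib's `PerfectRing R p`.) -/
class IsSemiperfect (p : ℕ) (R : Type*) [CommRing R] : Prop where
  surjective_frobenius : Function.Surjective fun x : R => x ^ p

instance IsFpAlgebra.tensorProduct (p : ℕ) (B C B' : Type*) [CommRing B] [CommRing C]
    [CommRing B'] [Algebra B C] [Algebra B B'] [IsFpAlgebra p C] :
    IsFpAlgebra p (C ⊗[B] B') where
  natCast_eq_zero := by
    have h := map_natCast (algebraMap C (C ⊗[B] B')) p
    rw [← h, IsFpAlgebra.natCast_eq_zero, map_zero]

/-! ### The Frobenius and the Fontainization `C♭` -/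

section Fontainization

variable (p : ℕ) [Fact p.Prime]

theorem IsFpAlgebra.add_pow {R : Type*} [CommRing R] [IsFpAlgebra p R] (x y : R) :
    (x + y) ^ p = x ^ p + y ^ p := by
  obtain ⟨r, hr⟩ := exists_add_pow_prime_eq (Fact.out : p.Prime) x y
  rw [hr, IsFpAlgebra.natCast_eq_zero (p := p) (R := R)]
  ring

/-- The Frobenius automorphism `x ↦ x ^ p` of a perfect `𝔽_p`-algebra. -/
def perfectFrobenius (R : Type*) [CommRing R] [IsFpAlgebra p R] [PerfectRing R p] : RingAut R :=
  RingEquiv.ofBijective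
    ({ toFun := fun x => x ^ p
       map_one' := one_pow p
       map_mul' := fun x y => mul_pow x y p
       map_zero' := zero_pow (Fact.out : p.Prime).ne_zero
       map_add' := IsFpAlgebra.add_pow p } : R →+* R)
    PerfectRing.bijective_frobenius

theorem perfectFrobenius_apply {R : Type*} [CommRing R] [IsFpAlgebra p R] [PerfectRing R p]
    (x : R) : perfectFrobenius p R x = x ^ p := rfl

/-- The Fontainization `C♭` as a subring of `ℕ → C`: the sequences `(c₀, c₁, …)` such that
`c_{n+1} ^ p = c_n` for all `n`. -/
def fontainization (C : Type*) [CommRing C] [IsFpAlgebra p C] : Subring (ℕ → C) where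
  carrier := {c | ∀ n, c (n + 1) ^ p = c n}
  mul_mem' {a b} ha hb n := by simp only [Pi.mul_apply, mul_pow, ha n, hb n]
  one_mem' n := one_pow p
  add_mem' {a b} ha hb n := by simp only [Pi.add_apply, IsFpAlgebra.add_pow p, ha n, hb n]
  zero_mem' n := zero_pow (Fact.out : p.Prime).ne_zero
  neg_mem' {a} ha n := by
    have h := IsFpAlgebra.add_pow p (a (n + 1)) (-a (n + 1))
    rw [add_neg_cancel, zero_pow (Fact.out : p.Prime).ne_zero, ha n] at h
    exact (neg_eq_of_add_eq_zero_right h.symm).symm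

/-- The Fontainization `C♭ = lim (⋯ → C → C)` along the Frobenius of `C`. -/
abbrev Fontainization (C : Type*) [CommRing C] [IsFpAlgebra p C] := ↥(fontainization p C)

namespace Fontainization

/-- The projection `ν_n : C♭ → C`, `(c₀, c₁, …) ↦ c_n`. -/
def proj (C : Type*) [CommRing C] [IsFpAlgebra p C] (n : ℕ) : Fontainization p C →+* C :=
  (Pi.evalRingHom (fun _ : ℕ => C) n).comp (fontainization p C).subtype

/-- Functoriality of the Fontainization. -/
def map {C D : Type*} [CommRing C] [CommRing D] [IsFpAlgebra p C] [IsFpAlgebra p D]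
    (f : C →+* D) : Fontainization p C →+* Fontainization p D where
  toFun c := ⟨fun n => f (c.1 n), fun n => by rw [← map_pow, c.2 n]⟩
  map_one' := by ext n; exact map_one f
  map_mul' a b := by ext n; exact map_mul f _ _
  map_zero' := by ext n; exact map_zero f
  map_add' a b := by ext n; exact map_add f _ _

/-- A homomorphism `φ : B → C` from a perfect `𝔽_p`-algebra `B` lifts to `B → C♭`,
`b ↦ (φ b, φ (b^{1/p}), φ (b^{1/p²}), …)`. -/
def lift {B C : Type*} [CommRing B] [CommRing C] [IsFpAlgebra p B] [IsFpAlgebra p C]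
    [PerfectRing B p] (φ : B →+* C) : B →+* Fontainization p C where
  toFun b := ⟨fun n => φ (((perfectFrobenius p B)⁻¹ ^ n) b), fun n => by
    rw [← map_pow, ← perfectFrobenius_apply, ← RingAut.mul_apply, pow_succ', mul_inv_cancel_left]⟩
  map_one' := by ext n; exact (congrArg φ (map_one _)).trans (map_one φ)
  map_mul' a b := by ext n; exact (congrArg φ (map_mul _ a b)).trans (map_mul φ _ _)
  map_zero' := by ext n; exact (congrArg φ (map_zero _)).trans (map_zero φ)
  map_add' a b := by ext n; exact (congrArg φ (map_add _ a b)).trans (map_add φ _ _)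

theorem map_comp_lift {B C D : Type*} [CommRing B] [CommRing C] [CommRing D] [IsFpAlgebra p B]
    [IsFpAlgebra p C] [IsFpAlgebra p D] [PerfectRing B p] (f : C →+* D) (φ : B →+* C) :
    (map p f).comp (lift p φ) = lift p (f.comp φ) := rfl

theorem lift_comp {B B' C : Type*} [CommRing B] [CommRing B'] [CommRing C] [IsFpAlgebra p B]
    [IsFpAlgebra p B'] [IsFpAlgebra p C] [PerfectRing B p] [PerfectRing B' p]
    (φ : B' →+* C) (ψ : B →+* B') :
    (lift p φ).comp ψ = lift p (φ.comp ψ) := by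
  have key : ∀ b, (perfectFrobenius p B')⁻¹ (ψ b) = ψ ((perfectFrobenius p B)⁻¹ b) := fun b => by
    apply (perfectFrobenius p B').injective
    rw [← RingAut.mul_apply, mul_inv_cancel, RingAut.one_apply, perfectFrobenius_apply,
      ← map_pow, ← perfectFrobenius_apply, ← RingAut.mul_apply, mul_inv_cancel, RingAut.one_apply]
  have key' : ∀ (n : ℕ) (b : B),
      ((perfectFrobenius p B')⁻¹ ^ n) (ψ b) = ψ (((perfectFrobenius p B)⁻¹ ^ n) b) := by
    intro n
    induction n with
    | zero => intro b; rfl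
    | succ n ih =>
      intro b
      rw [pow_succ', pow_succ', RingAut.mul_apply, RingAut.mul_apply, ih, key]
  ext b n
  exact congrArg φ (key' n b)

end Fontainization

end Fontainization

/-! ### PD hulls -/

section PDHull

variable (p : ℕ)

/-- The ideal of the divided power algebra `Γ_A(I)` of the `A`-module `I` that is generated by
`x^{[1]} - x` for `x ∈ I` and, if `p ∈ I`, by `p^{[m]} - p^m/m!` for `m ∈ ℕ`. The latter relation
is written without division: if `p^m/m! = a/b` in lowest terms (`b` is then prime to `p`), then it
is `b * p^{[m]} - a`. -/
def pdHullIdeal {A : Type*} [CommRing A] (I : Ideal A) : Ideal (DividedPowerAlgebra A I) :=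
  Ideal.span
    ({z | ∃ x : I, z = DividedPowerAlgebra.dp A 1 x - algebraMap A _ (x : A)} ∪
      {z | ∃ (h : (p : A) ∈ I) (m : ℕ),
        z = ((((p : ℚ) ^ m / (m.factorial : ℚ)).den : ℕ) : DividedPowerAlgebra A I) *
              DividedPowerAlgebra.dp A m (⟨(p : A), h⟩ : I) -
            ((((p : ℚ) ^ m / (m.factorial : ℚ)).num : ℤ) : DividedPowerAlgebra A I)})

/-- The PD hull of `A ↠ A/I`, where `A` is a `ℤ_(p)`-algebra and `p ∈ I`, with PD structures
required to satisfy `γ_m(p) = p^m/m!`. This is the usual construction (Berthelot, Berthelot-Ogus)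
as the quotient of the divided power algebra `Γ_A(I)` by the ideal generated by the elements
`x^{[1]} - x` (`x ∈ I`) and `p^{[m]} - p^m/m!`; the PD ideal is the image of the augmentation ideal
of `Γ_A(I)`, and `γ_m(x)` is the class of `x^{[m]}` for `x ∈ I`. -/
def PDHull {A : Type*} [CommRing A] (I : Ideal A) := DividedPowerAlgebra A I ⧸ pdHullIdeal p I

namespace PDHull

instance {A : Type*} [CommRing A] (I : Ideal A) : CommRing (PDHull p I) :=
  inferInstanceAs (CommRing (DividedPowerAlgebra A I ⧸ pdHullIdeal p I))

/-- The canonical homomorphism from `A` to the PD hull. -/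
def of {A : Type*} [CommRing A] (I : Ideal A) : A →+* PDHull p I :=
  (Ideal.Quotient.mk (pdHullIdeal p I)).comp (algebraMap A (DividedPowerAlgebra A I))

/-- The divided power `γ_m(x)`, `x ∈ I`, as an element of the PD hull. -/
def gamma {A : Type*} [CommRing A] (I : Ideal A) (m : ℕ) (x : I) : PDHull p I :=
  Ideal.Quotient.mk (pdHullIdeal p I) (DividedPowerAlgebra.dp A m x)

theorem gamma_one {A : Type*} [CommRing A] (I : Ideal A) (x : I) :
    gamma p I 1 x = of p I (x : A) :=
  Ideal.Quotient.eq.mpr (Ideal.subset_span (Or.inl ⟨x, rfl⟩))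

section Map

variable {A A' : Type*} [CommRing A] [CommRing A'] {I : Ideal A} {I' : Ideal A'}
  (f : A →+* A') (hf : ∀ x ∈ I, f x ∈ I')

/-- The homomorphism `Γ_A(I) → Γ_{A'}(I')`, `x^{[m]} ↦ f(x)^{[m]}`, given by a homomorphism
`f : A → A'` with `f(I) ⊆ I'`. -/
def mapAux : DividedPowerAlgebra A I →+* DividedPowerAlgebra A' I' :=
  letI : Algebra A (DividedPowerAlgebra A' I') :=
    ((algebraMap A' (DividedPowerAlgebra A' I')).comp f).toAlgebra
  (DividedPowerAlgebra.lift' (R := A) (M := I) (A := DividedPowerAlgebra A' I')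
    (f := fun nx => DividedPowerAlgebra.dp A' nx.1 (⟨f nx.2, hf _ nx.2.2⟩ : I'))
    (fun _ => DividedPowerAlgebra.dp_zero)
    (fun n r m => by
      have h : (⟨f ((r • m : I) : A), hf _ (r • m : I).2⟩ : I') = f r • ⟨f (m : A), hf _ m.2⟩ :=
        Subtype.ext (map_mul f r (m : A))
      dsimp only
      rw [h, DividedPowerAlgebra.dp_smul, Algebra.smul_def, Algebra.smul_def, map_pow, map_pow]
      rfl)
    (fun _ _ _ => DividedPowerAlgebra.dp_mul)
    (fun n u v => by
      have h : (⟨f ((u + v : I) : A), hf _ (u + v : I).2⟩ : I') =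
          ⟨f (u : A), hf _ u.2⟩ + ⟨f (v : A), hf _ v.2⟩ :=
        Subtype.ext (map_add f (u : A) (v : A))
      dsimp only
      rw [h, DividedPowerAlgebra.dp_add])).toRingHom

theorem mapAux_dp (m : ℕ) (x : I) :
    mapAux f hf (DividedPowerAlgebra.dp A m x) =
      DividedPowerAlgebra.dp A' m (⟨f x, hf _ x.2⟩ : I') := by
  let _ : Algebra A (DividedPowerAlgebra A' I') :=
    ((algebraMap A' (DividedPowerAlgebra A' I')).comp f).toAlgebra
  exact DividedPowerAlgebra.lift'_apply_dp (R := A) (M := I) _ _ _ _ m x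

theorem mapAux_algebraMap (a : A) :
    mapAux f hf (algebraMap A _ a) = algebraMap A' _ (f a) := by
  let _ : Algebra A (DividedPowerAlgebra A' I') :=
    ((algebraMap A' (DividedPowerAlgebra A' I')).comp f).toAlgebra
  exact AlgHom.commutes _ a

theorem mapAux_mem (z : DividedPowerAlgebra A I) (hz : z ∈ pdHullIdeal p I) :
    mapAux f hf z ∈ pdHullIdeal p I' := by
  suffices h : pdHullIdeal p I ≤ (pdHullIdeal p I').comap (mapAux f hf) from h hz
  refine Ideal.span_le.mpr ?_
  rintro z (⟨x, rfl⟩ | ⟨h, m, rfl⟩)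
  · refine Ideal.subset_span (Or.inl ⟨⟨f x, hf _ x.2⟩, ?_⟩)
    rw [map_sub, mapAux_dp, mapAux_algebraMap]
  · have h' : (p : A') ∈ I' := by simpa using hf _ h
    refine Ideal.subset_span (Or.inr ⟨h', m, ?_⟩)
    rw [map_sub, map_mul, map_natCast, map_intCast, mapAux_dp]
    congr 4
    exact map_natCast f p

/-- Functoriality of the PD hull. -/
def map : PDHull p I →+* PDHull p I' :=
  Ideal.quotientMap (pdHullIdeal p I') (mapAux f hf) (fun z hz => mapAux_mem p f hf z hz)

theorem map_of (a : A) : map p f hf (of p I a) = of p I' (f a) :=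
  congrArg (Ideal.Quotient.mk _) (mapAux_algebraMap f hf a)

theorem map_gamma (m : ℕ) (x : I) :
    map p f hf (gamma p I m x) = gamma p I' m ⟨f x, hf _ x.2⟩ :=
  congrArg (Ideal.Quotient.mk _) (mapAux_dp f hf m x)

end Map

end PDHull

end PDHull

/-! ### `p`-adic completion -/

section PCompletion

variable (p : ℕ)

/-- The `p`-adic completion `lim R/p^n R` of a ring `R`. -/
abbrev PCompletion (R : Type*) [CommRing R] := AdicCompletion (Ideal.span {(p : R)}) R

namespace PCompletion

/-- The canonical homomorphism from `R` to its `p`-adic completion. -/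
abbrev of (R : Type*) [CommRing R] : R →+* PCompletion p R := algebraMap R (PCompletion p R)

variable {R S : Type*} [CommRing R] [CommRing S]

theorem factorPow_evalₐ (I : Ideal R) {m n : ℕ} (hle : m ≤ n) (x : AdicCompletion I R) :
    Ideal.Quotient.factorPow I hle (AdicCompletion.evalₐ I n x) = AdicCompletion.evalₐ I m x := by
  induction x using AdicCompletion.induction_on with
  | _ a =>
    rw [AdicCompletion.evalₐ_mk, AdicCompletion.evalₐ_mk]
    exact AdicCompletion.Ideal.mk_eq_mk I hle a

/-- The homomorphism `R/p^n R → S/p^n S` induced by `g : R → lim S/p^n S`. -/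
def liftAux (g : R →+* PCompletion p S) (n : ℕ) :
    R ⧸ Ideal.span {(p : R)} ^ n →+* S ⧸ Ideal.span {(p : S)} ^ n :=
  Ideal.Quotient.lift _
    (((AdicCompletion.evalₐ (Ideal.span {(p : S)}) n : _ →+* _)).comp g) (by
      intro a ha
      rw [Ideal.span_singleton_pow, Ideal.mem_span_singleton'] at ha
      obtain ⟨b, rfl⟩ := ha
      have h0 : ((p : S ⧸ Ideal.span {(p : S)} ^ n)) ^ n = 0 := by
        rw [← map_natCast (Ideal.Quotient.mk (Ideal.span {(p : S)} ^ n)), ← map_pow]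
        exact Ideal.Quotient.eq_zero_iff_mem.mpr
          (Ideal.pow_mem_pow (Ideal.mem_span_singleton_self _) n)
      rw [map_mul, map_pow, map_natCast, h0, mul_zero])

theorem factorPow_comp_liftAux (g : R →+* PCompletion p S) {m n : ℕ} (hle : m ≤ n) :
    (Ideal.Quotient.factorPow (Ideal.span {(p : S)}) hle).comp
        ((liftAux p g n).comp (AdicCompletion.evalₐ (Ideal.span {(p : R)}) n).toRingHom) =
      (liftAux p g m).comp (AdicCompletion.evalₐ (Ideal.span {(p : R)}) m).toRingHom := by
  ext x
  obtain ⟨a, ha⟩ := Ideal.Quotient.mk_surjective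
    (AdicCompletion.evalₐ (Ideal.span {(p : R)}) n x)
  have hm : AdicCompletion.evalₐ (Ideal.span {(p : R)}) m x = Ideal.Quotient.mk _ a := by
    rw [← factorPow_evalₐ _ hle, ← ha]
    rfl
  change Ideal.Quotient.factorPow _ hle
    (liftAux p g n (AdicCompletion.evalₐ (Ideal.span {(p : R)}) n x)) =
      liftAux p g m (AdicCompletion.evalₐ (Ideal.span {(p : R)}) m x)
  rw [← ha, hm]
  exact factorPow_evalₐ _ hle (g a)

/-- The unique `p`-adically continuous extension to the `p`-adic completion of `R` of a homomorphism
from `R` to the `p`-adic completion of `S`. -/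
def lift (g : R →+* PCompletion p S) : PCompletion p R →+* PCompletion p S :=
  AdicCompletion.liftRingHom (Ideal.span {(p : S)})
    (fun n => (liftAux p g n).comp (AdicCompletion.evalₐ (Ideal.span {(p : R)}) n).toRingHom)
    (factorPow_comp_liftAux p g)

theorem lift_of (g : R →+* PCompletion p S) (r : R) : lift p g (of p R r) = g r := by
  refine AdicCompletion.ext_evalₐ fun n => ?_
  refine (AdicCompletion.evalₐ_liftRingHom _ _ (factorPow_comp_liftAux p g) n _).trans ?_
  change liftAux p g n (AdicCompletion.evalₐ (Ideal.span {(p : R)}) n (algebraMap R _ r)) = _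
  rw [AlgHom.commutes]
  rfl

/-- Functoriality of the `p`-adic completion. -/
def map (f : R →+* S) : PCompletion p R →+* PCompletion p S := lift p ((of p S).comp f)

theorem map_of (f : R →+* S) (r : R) : map p f (of p R r) = of p S (f r) := lift_of p _ r

end PCompletion

end PCompletion

/-! ### Fontaine's ring `A_cris(C)` -/

section Acris

variable (p : ℕ) [Fact p.Prime]

instance WittVector.algebraOfAlgebra (B B' : Type*) [CommRing B] [CommRing B'] [Algebra B B'] :
    Algebra (WittVector p B) (WittVector p B') :=
  (WittVector.map (algebraMap B B')).toAlgebra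

/-- The homomorphism `W(C♭) → C` induced by `ν₀ : C♭ → C`; it is surjective if `C` is
semiperfect. -/
def wittToBase (C : Type*) [CommRing C] [IsFpAlgebra p C] :
    WittVector p (Fontainization p C) →+* C :=
  (Fontainization.proj p C 0).comp WittVector.constantCoeff

/-- `A_cris(C)` for a semiperfect `𝔽_p`-algebra `C`: the `p`-adic completion of the PD hull of
`W(C♭) ↠ C`. -/
def Acris (C : Type*) [CommRing C] [IsFpAlgebra p C] :=
  PCompletion p (PDHull p (RingHom.ker (wittToBase p C)))

namespace Acris

instance (C : Type*) [CommRing C] [IsFpAlgebra p C] : CommRing (Acris p C) :=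
  inferInstanceAs (CommRing (PCompletion p (PDHull p (RingHom.ker (wittToBase p C)))))

/-- The canonical homomorphism `W(C♭) → A_cris(C)`. -/
def ofWitt (C : Type*) [CommRing C] [IsFpAlgebra p C] :
    WittVector p (Fontainization p C) →+* Acris p C :=
  (PCompletion.of p (PDHull p (RingHom.ker (wittToBase p C)))).comp (PDHull.of p _)

theorem wittToBase_map {C D : Type*} [CommRing C] [CommRing D] [IsFpAlgebra p C]
    [IsFpAlgebra p D] (f : C →+* D) (x : WittVector p (Fontainization p C)) :
    wittToBase p D (WittVector.map (Fontainization.map p f) x) = f (wittToBase p C x) := by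
  rfl

/-- Functoriality of `A_cris`. -/
def map {C D : Type*} [CommRing C] [CommRing D] [IsFpAlgebra p C] [IsFpAlgebra p D]
    (f : C →+* D) : Acris p C →+* Acris p D :=
  PCompletion.map p (PDHull.map p (WittVector.map (Fontainization.map p f)) (fun x hx => by
    rw [RingHom.mem_ker] at hx ⊢
    rw [wittToBase_map, hx, map_zero]))

theorem map_ofWitt {C D : Type*} [CommRing C] [CommRing D] [IsFpAlgebra p C] [IsFpAlgebra p D]
    (f : C →+* D) (x : WittVector p (Fontainization p C)) :
    map p f (ofWitt p C x) = ofWitt p D (WittVector.map (Fontainization.map p f) x) :=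
  (PCompletion.map_of p _ _).trans (congrArg _ (PDHull.map_of p _ _ x))

/-- The homomorphism `W(B) → W(C♭) → A_cris(C)` induced by a homomorphism `φ : B → C`, where `B`
is perfect. -/
def ofBase {B C : Type*} [CommRing B] [CommRing C] [IsFpAlgebra p B] [IsFpAlgebra p C]
    [PerfectRing B p] (φ : B →+* C) : WittVector p B →+* Acris p C :=
  (ofWitt p C).comp (WittVector.map (Fontainization.lift p φ))

theorem map_ofBase {B C D : Type*} [CommRing B] [CommRing C] [CommRing D] [IsFpAlgebra p B]
    [IsFpAlgebra p C] [IsFpAlgebra p D] [PerfectRing B p] (f : C →+* D) (φ : B →+* C)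
    (x : WittVector p B) : map p f (ofBase p φ x) = ofBase p (f.comp φ) x := by
  refine (map_ofWitt p f _).trans (congrArg (ofWitt p D) ?_)
  ext n
  rfl

theorem ofBase_map {B B' C : Type*} [CommRing B] [CommRing B'] [CommRing C] [IsFpAlgebra p B]
    [IsFpAlgebra p B'] [IsFpAlgebra p C] [PerfectRing B p] [PerfectRing B' p]
    (φ : B' →+* C) (ψ : B →+* B') (x : WittVector p B) :
    ofBase p φ (WittVector.map ψ x) = ofBase p (φ.comp ψ) x := by
  refine congrArg (ofWitt p C) ?_
  rw [← Fontainization.lift_comp p φ ψ]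
  ext n
  rfl

/-- If `B` is perfect and `C` is a `B`-algebra, then `A_cris(C)` is a `W(B)`-algebra. -/
instance (B C : Type*) [CommRing B] [CommRing C] [IsFpAlgebra p B] [IsFpAlgebra p C]
    [PerfectRing B p] [Algebra B C] : Algebra (WittVector p B) (Acris p C) :=
  (ofBase p (algebraMap B C)).toAlgebra

section BaseChange

variable (B B' C : Type*) [CommRing B] [CommRing B'] [CommRing C] [IsFpAlgebra p B]
  [IsFpAlgebra p B'] [IsFpAlgebra p C] [PerfectRing B p] [PerfectRing B' p] [Algebra B B']
  [Algebra B C]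

/-- The canonical homomorphism `A_cris(C) ⊗_{W(B)} W(B') → A_cris(C ⊗_B B')`: on `A_cris(C)` it is
induced by `C → C ⊗_B B'`, and on `W(B')` it is induced by `B' → C ⊗_B B'`. -/
def tensorMap : Acris p C ⊗[WittVector p B] WittVector p B' →+* Acris p (C ⊗[B] B') :=
  (Algebra.TensorProduct.lift (R := WittVector p B) (S := WittVector p B)
    ({ map p (Algebra.TensorProduct.includeLeft : C →ₐ[B] C ⊗[B] B').toRingHom with
        commutes' := fun x => (map_ofBase p _ _ x).trans rfl } :
      Acris p C →ₐ[WittVector p B] Acris p (C ⊗[B] B'))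
    ({ ofBase p (Algebra.TensorProduct.includeRight : B' →ₐ[B] C ⊗[B] B').toRingHom with
        commutes' := fun x => (ofBase_map p _ _ x).trans (by
          rw [AlgHom.toRingHom_eq_coe, AlgHom.comp_algebraMap]
          rfl) } :
      WittVector p B' →ₐ[WittVector p B] Acris p (C ⊗[B] B'))
    (fun _ _ => Commute.all _ _)).toRingHom

theorem tensorMap_tmul (x : Acris p C) (y : WittVector p B') :
    tensorMap p B B' C (x ⊗ₜ y) =
      map p (Algebra.TensorProduct.includeLeft : C →ₐ[B] C ⊗[B] B').toRingHom x *
        ofBase p (Algebra.TensorProduct.includeRight : B' →ₐ[B] C ⊗[B] B').toRingHom y :=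
  rfl

/-- The completed tensor product `A_cris(C) ⊗̂_{W(B)} W(B')`, i.e. the `p`-adic completion of
`A_cris(C) ⊗_{W(B)} W(B')`. -/
abbrev CompletedTensor := PCompletion p (Acris p C ⊗[WittVector p B] WittVector p B')

/-- The canonical homomorphism `A_cris(C) ⊗̂_{W(B)} W(B') → A_cris(C ⊗_B B')`, the `p`-adically
continuous extension of `tensorMap`. -/
def baseChangeMap : CompletedTensor p B B' C →+* Acris p (C ⊗[B] B') :=
  PCompletion.lift p (tensorMap p B B' C)

end BaseChange

end Acris

end Acris

end

noncomputable section

/-! ### Witt vectors of `𝔽_p`-algebras -/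

section Witt

variable (p : ℕ) [Fact p.Prime]

/-! Notation: P = C♭, D = C ⊗_B B', X = W(P) ⊗_{W(B)} W(B'), I = ker(W(P) → C), J = ker(P → C), M =
X ⊗_{W(P)} I with its map ι : M → X, and H = the PD hull of W(D♭) → D.

It suffices to prove bijectivity modulo every p^n (`PCompletion.lift_bijective`,
`tensorMapMod_bijective`). The inverse modulo p^n comes from a universal property: for a ring Q with
p^n = 0, a homomorphism H → Q amounts to a pair of homomorphisms to Q, from the PD hull of W(P) → C
and from W(B'), that agree on W(B). Existence is `exists_pdHull_lift`, uniqueness is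
`pdHull_ringHom_ext`.

Divided powers become linear data. A homomorphism from the PD hull of I ⊆ A to an A-algebra Q is an
A-linear map from I to the module `ExpSeries Q`, sending x to the series of the γ_m(x), with
conditions on the first coefficients and on the image of p. Such a map extends by scalars to E : M →
`ExpSeries Q`. It remains to pass from (X, M) to W(D♭) and the kernel of W(D♭) → D, which is done by
approximation.

Density: every element of W(D♭) is congruent to one from X modulo the kernel of W(D♭) → W_r(D)
induced by ν_k, for k ≥ r (`KernelModel.exists_sub_mem_nearZero`). Continuity: if ν_k kills the
zeroth coefficient of ι(u), then u = ι(e)^{p^k-1} e + w·[p] in M, where [p] is the class of p. The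
image of ι(e)^N in Q is N!·E(e)_N, which is 0 for N ≥ np. So only the second term survives;
repeating this for w shows that elements close enough to 0 have image divisible by p^n in Q, hence
0, and that E vanishes on the corresponding elements of M
(`KernelModel.exp_eq_zero_of_mem_nearZero`).

Flatness gives the decomposition in M itself. Teichmüller representatives are additive modulo p, so
M modulo [p] is a quotient of J ⊗_B B', and J ⊗_B B' → P ⊗_B B' is injective. Hence an element of M
that vanishes in P ⊗_B B' is a multiple of [p] (`WittTensor.exists_eq_smul_of_coeffZero_incl`). -/

theorem IsFpAlgebra.subsingleton_or_charP (R : Type*) [CommRing R] [IsFpAlgebra p R] :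
    Subsingleton R ∨ CharP R p := by
  cases subsingleton_or_nontrivial R with
  | inl h => exact Or.inl h
  | inr h =>
    exact Or.inr ((CharP.charP_iff_prime_eq_zero Fact.out).2 IsFpAlgebra.natCast_eq_zero)

namespace WittVector

variable {R : Type*} [CommRing R] [IsFpAlgebra p R]

theorem coeff_zero_natCast_mul (x : WittVector p R) : ((p : WittVector p R) * x).coeff 0 = 0 := by
  rcases IsFpAlgebra.subsingleton_or_charP p R with h | h
  · exact Subsingleton.elim _ _
  · rw [mul_comm, mul_charP_coeff_zero]

theorem coeff_succ_natCast_mul (x : WittVector p R) (i : ℕ) :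
    ((p : WittVector p R) * x).coeff (i + 1) = x.coeff i ^ p := by
  rcases IsFpAlgebra.subsingleton_or_charP p R with h | h
  · exact Subsingleton.elim _ _
  · rw [mul_comm, mul_charP_coeff_succ]

theorem coeff_natCast_pow_mul (x : WittVector p R) {i n : ℕ} (h : i < n) :
    ((p : WittVector p R) ^ n * x).coeff i = 0 := by
  induction n generalizing i with
  | zero => omega
  | succ n ih =>
    rw [pow_succ', mul_assoc]
    cases i with
    | zero => exact coeff_zero_natCast_mul p _
    | succ i =>
      rw [coeff_succ_natCast_mul, ih (by omega), zero_pow (Fact.out : p.Prime).ne_zero]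

/-- Multiplication by p shifts the coefficients and raises them to the p-th power, so w consists of
the p-th roots of the shifted coefficients of x. -/
theorem exists_eq_natCast_mul [PerfectRing R p] (x : WittVector p R) (hx : x.coeff 0 = 0) :
    ∃ w, x = p * w := by
  choose r hr using (PerfectRing.bijective_frobenius (R := R) (p := p)).2
  refine ⟨WittVector.mk p fun i => r (x.coeff (i + 1)), ?_⟩
  ext i
  cases i with
  | zero => rw [hx, coeff_zero_natCast_mul]
  | succ i => rw [coeff_succ_natCast_mul]; exact (hr _).symm

theorem exists_eq_teichmuller_add [PerfectRing R p] (x : WittVector p R) :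
    ∃ w, x = teichmuller p (x.coeff 0) + p * w := by
  obtain ⟨w, hw⟩ := exists_eq_natCast_mul p (x - teichmuller p (x.coeff 0)) (by
    change constantCoeff (x - teichmuller p (x.coeff 0)) = 0
    rw [map_sub]
    exact sub_self _)
  exact ⟨w, by rw [← hw, add_sub_cancel]⟩

theorem exists_teichmuller_add [PerfectRing R p] (x y : R) :
    ∃ w, teichmuller p (x + y) = teichmuller p x + teichmuller p y + p * w := by
  obtain ⟨w, hw⟩ := exists_eq_teichmuller_add p (teichmuller p x + teichmuller p y)
  rw [add_coeff_zero, teichmuller_coeff_zero, teichmuller_coeff_zero] at hw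
  exact ⟨-w, by rw [hw]; ring⟩

end WittVector

end Witt

/-! ### Exponential sequences -/

/-- Sequences `a` with `a 0 = 1` and `a m * a n = binom (m + n) m * a (m + n)`, i.e. the exponential
power series `∑ a n * T ^ n`. -/
@[ext] structure ExpSeries (R : Type*) [CommRing R] where
  coeff : ℕ → R
  coeff_zero : coeff 0 = 1
  coeff_mul_coeff : ∀ m n, coeff m * coeff n = (m + n).choose m * coeff (m + n)

namespace ExpSeries

variable {R : Type*} [CommRing R]

/-- Makes the range of an inner sum independent of (i, j), so that the two sums in `conv_mul_conv`
can be exchanged. -/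
theorem sum_antidiagonal_shift (F : ℕ → ℕ → R) (i j n : ℕ)
    (hF : ∀ s t, s < i ∨ t < j → F s t = 0) :
    ∑ kl ∈ Finset.HasAntidiagonal.antidiagonal n, F (i + kl.1) (j + kl.2) =
      ∑ st ∈ Finset.HasAntidiagonal.antidiagonal (i + j + n), F st.1 st.2 := by
  refine Finset.sum_of_injOn (fun kl => (i + kl.1, j + kl.2)) ?_ ?_ ?_ ?_
  · rintro ⟨a, b⟩ _ ⟨c, d⟩ _ h
    simp only [Prod.mk.injEq] at h ⊢
    omega
  · rintro ⟨a, b⟩ h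
    simp only [Finset.mem_coe, Finset.HasAntidiagonal.mem_antidiagonal] at h ⊢
    omega
  · rintro ⟨s, t⟩ h h'
    refine hF s t ?_
    by_contra! hc
    refine h' ⟨(s - i, t - j), ?_, ?_⟩
    · simp only [Finset.mem_coe, Finset.HasAntidiagonal.mem_antidiagonal] at h ⊢
      omega
    · simp only [Prod.mk.injEq]
      omega
  · intro _ _
    rfl

/-- The coefficient of a_s b_t on the left is the sum of binom(s, i) binom(t, j) over i + j = m,
which is binom(s + t, m) by Vandermonde. -/
theorem conv_mul_conv (a b : ExpSeries R) (m n : ℕ) :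
    (∑ ij ∈ Finset.HasAntidiagonal.antidiagonal m, a.coeff ij.1 * b.coeff ij.2) *
        (∑ kl ∈ Finset.HasAntidiagonal.antidiagonal n, a.coeff kl.1 * b.coeff kl.2) =
      (m + n).choose m *
        ∑ st ∈ Finset.HasAntidiagonal.antidiagonal (m + n), a.coeff st.1 * b.coeff st.2 := by
  rw [Finset.sum_mul, Finset.mul_sum]
  have h1 : ∀ ij ∈ Finset.HasAntidiagonal.antidiagonal m,
      a.coeff ij.1 * b.coeff ij.2 *
          (∑ kl ∈ Finset.HasAntidiagonal.antidiagonal n, a.coeff kl.1 * b.coeff kl.2) =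
        ∑ st ∈ Finset.HasAntidiagonal.antidiagonal (m + n),
          ((st.1.choose ij.1 * st.2.choose ij.2 : ℕ) : R) * (a.coeff st.1 * b.coeff st.2) := by
    rintro ⟨i, j⟩ hij
    rw [Finset.HasAntidiagonal.mem_antidiagonal] at hij
    subst hij
    rw [← sum_antidiagonal_shift (fun s t => ((s.choose i * t.choose j : ℕ) : R) *
      (a.coeff s * b.coeff t)) i j n, Finset.mul_sum]
    · refine Finset.sum_congr rfl ?_
      rintro ⟨k, l⟩ _
      have ha := a.coeff_mul_coeff i k
      have hb := b.coeff_mul_coeff j l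
      dsimp only
      push_cast
      linear_combination b.coeff j * b.coeff l * ha + (i + k).choose i * a.coeff (i + k) * hb
    · rintro s t (h | h)
      · rw [Nat.choose_eq_zero_of_lt h]; simp
      · rw [Nat.choose_eq_zero_of_lt h]; simp
  rw [Finset.sum_congr rfl h1, Finset.sum_comm]
  refine Finset.sum_congr rfl ?_
  rintro ⟨s, t⟩ hst
  rw [Finset.HasAntidiagonal.mem_antidiagonal] at hst
  dsimp only at hst ⊢
  rw [← Finset.sum_mul, ← hst, Nat.add_choose_eq s t m]
  push_cast
  rfl

instance : Zero (ExpSeries R) where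
  zero :=
    { coeff := fun n => if n = 0 then 1 else 0
      coeff_zero := if_pos rfl
      coeff_mul_coeff := fun m n => by
        rcases Nat.eq_zero_or_pos m with rfl | hm
        · simp
        · simp [hm.ne'] }

instance : Add (ExpSeries R) where
  add a b :=
    { coeff := fun n => ∑ ij ∈ Finset.HasAntidiagonal.antidiagonal n, a.coeff ij.1 * b.coeff ij.2
      coeff_zero := by simp [a.coeff_zero, b.coeff_zero]
      coeff_mul_coeff := conv_mul_conv a b }

theorem coeff_zero_series (n : ℕ) : (0 : ExpSeries R).coeff n = if n = 0 then 1 else 0 := rfl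

theorem coeff_add (a b : ExpSeries R) (n : ℕ) :
    (a + b).coeff n = ∑ ij ∈ Finset.HasAntidiagonal.antidiagonal n,
      a.coeff ij.1 * b.coeff ij.2 := rfl

theorem mk_add (a b : ExpSeries R) :
    PowerSeries.mk (a + b).coeff = PowerSeries.mk a.coeff * PowerSeries.mk b.coeff := by
  ext n
  simp [PowerSeries.coeff_mul, coeff_add]

theorem mk_zero : PowerSeries.mk (0 : ExpSeries R).coeff = 1 := by
  ext n
  simp [PowerSeries.coeff_one, coeff_zero_series]

theorem mk_injective :
    Function.Injective fun a : ExpSeries R => PowerSeries.mk a.coeff := fun a b h => by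
  ext n
  simpa using congrArg (PowerSeries.coeff n) h

instance : AddCommMonoid (ExpSeries R) where
  add_assoc a b c := mk_injective (by simp only [mk_add, mul_assoc])
  zero_add a := mk_injective (by simp only [mk_add, mk_zero, one_mul])
  add_zero a := mk_injective (by simp only [mk_add, mk_zero, mul_one])
  add_comm a b := mk_injective (by simp only [mk_add, mul_comm])
  nsmul := nsmulRec

section Module

variable {S : Type*} [CommRing S] [Algebra S R]

instance : SMul S (ExpSeries R) where
  smul s a :=
    { coeff := fun n => algebraMap S R s ^ n * a.coeff n
      coeff_zero := by simp [a.coeff_zero]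
      coeff_mul_coeff := fun m n => by
        linear_combination algebraMap S R s ^ m * algebraMap S R s ^ n * a.coeff_mul_coeff m n }

theorem coeff_smul (s : S) (a : ExpSeries R) (n : ℕ) :
    (s • a).coeff n = algebraMap S R s ^ n * a.coeff n := rfl

instance : Module S (ExpSeries R) where
  one_smul a := by ext n; simp [coeff_smul]
  mul_smul s t a := by ext n; simp [coeff_smul, mul_pow, mul_assoc]
  smul_zero s := by
    ext n
    rcases Nat.eq_zero_or_pos n with rfl | hn
    · simp [coeff_smul, coeff_zero_series]
    · simp [coeff_smul, coeff_zero_series, hn.ne']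
  smul_add s a b := by
    ext n
    rw [coeff_smul, coeff_add, coeff_add, Finset.mul_sum]
    refine Finset.sum_congr rfl fun ij hij => ?_
    rw [coeff_smul, coeff_smul, ← Finset.HasAntidiagonal.mem_antidiagonal.1 hij, pow_add]
    ring
  -- The binomial theorem: binom(n, i) a_n = a_i a_j for i + j = n.
  add_smul s t a := by
    ext n
    rw [coeff_smul, coeff_add, map_add, Commute.add_pow' (Commute.all _ _), Finset.sum_mul]
    refine Finset.sum_congr rfl fun ij hij => ?_
    have h := a.coeff_mul_coeff ij.1 ij.2
    rw [Finset.HasAntidiagonal.mem_antidiagonal.1 hij] at h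
    rw [coeff_smul, coeff_smul, nsmul_eq_mul]
    linear_combination -(algebraMap S R s ^ ij.1 * algebraMap S R t ^ ij.2) * h
  zero_smul a := by
    ext n
    rcases Nat.eq_zero_or_pos n with rfl | hn
    · simp [coeff_smul, coeff_zero_series, a.coeff_zero]
    · simp [coeff_smul, coeff_zero_series, hn.ne']

instance {S' : Type*} [CommRing S'] [Algebra S' R] [Algebra S S'] [IsScalarTower S S' R] :
    IsScalarTower S S' (ExpSeries R) where
  smul_assoc s t a := by
    ext n
    rw [coeff_smul, coeff_smul, coeff_smul, Algebra.smul_def, map_mul, mul_pow, mul_assoc,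
      ← IsScalarTower.algebraMap_apply]

end Module

/-- The source of nilpotence: where p^n = 0, the power on the left vanishes as soon as p^n divides
the factorial. -/
theorem coeff_one_pow (a : ExpSeries R) (n : ℕ) :
    a.coeff 1 ^ n = n.factorial * a.coeff n := by
  induction n with
  | zero => simp [a.coeff_zero]
  | succ n ih =>
    have h := a.coeff_mul_coeff n 1
    rw [Nat.choose_succ_self_right] at h
    rw [pow_succ, ih, Nat.factorial_succ]
    push_cast at h ⊢
    linear_combination (n.factorial : R) * h

/-- The image of an exponential sequence under a ring homomorphism. -/
def map {S : Type*} [CommRing S] (f : R →+* S) (a : ExpSeries R) : ExpSeries S where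
  coeff n := f (a.coeff n)
  coeff_zero := by rw [a.coeff_zero, map_one]
  coeff_mul_coeff m n := by rw [← map_mul, a.coeff_mul_coeff, map_mul, map_natCast]

end ExpSeries

/-! ### The universal property of PD hulls -/

namespace PDHull

variable (p : ℕ) {A : Type*} [CommRing A] (I : Ideal A)

section Lift

variable {R : Type*} [CommRing R] [Algebra A R] (E : I →ₗ[A] ExpSeries R)
  (h1 : ∀ x : I, (E x).coeff 1 = algebraMap A R x)
  (hp : ∀ (h : (p : A) ∈ I) (m : ℕ),
    ((((p : ℚ) ^ m / (m.factorial : ℚ)).den : ℕ) : R) * (E ⟨p, h⟩).coeff m =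
      ((((p : ℚ) ^ m / (m.factorial : ℚ)).num : ℤ) : R))

/-- The homomorphism on the divided power algebra given by a linear map to exponential
sequences. -/
def liftAux : DividedPowerAlgebra A I →ₐ[A] R :=
  DividedPowerAlgebra.lift' (f := fun nx : ℕ × I => (E nx.2).coeff nx.1)
    (fun x => (E x).coeff_zero)
    (fun n r x => by
      dsimp only
      rw [map_smul, ExpSeries.coeff_smul, Algebra.smul_def, map_pow])
    (fun m n x => by
      dsimp only
      rw [(E x).coeff_mul_coeff, nsmul_eq_mul])
    (fun n x y => by
      dsimp only
      rw [map_add, ExpSeries.coeff_add])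

theorem liftAux_dp (n : ℕ) (x : I) :
    liftAux I E (DividedPowerAlgebra.dp A n x) = (E x).coeff n :=
  DividedPowerAlgebra.lift'_apply_dp _ _ _ _ n x

/-- The universal property of the PD hull. -/
def lift : PDHull p I →+* R :=
  Ideal.Quotient.lift (pdHullIdeal p I) (liftAux I E).toRingHom (by
    suffices h : pdHullIdeal p I ≤ RingHom.ker (liftAux I E).toRingHom from fun a ha => h ha
    refine Ideal.span_le.2 ?_
    rintro z (⟨x, rfl⟩ | ⟨h, m, rfl⟩)
    · change liftAux I E _ = 0
      rw [map_sub, liftAux_dp, AlgHom.commutes, h1, sub_self]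
    · change liftAux I E _ = 0
      rw [map_sub, map_mul, liftAux_dp, map_natCast, map_intCast, hp, sub_self])

theorem lift_of (a : A) : lift p I E h1 hp (of p I a) = algebraMap A R a :=
  (liftAux I E).commutes a

theorem lift_gamma (m : ℕ) (x : I) : lift p I E h1 hp (gamma p I m x) = (E x).coeff m :=
  liftAux_dp I E m x

end Lift

theorem ringHom_ext {R : Type*} [CommRing R] {f g : PDHull p I →+* R}
    (hof : ∀ a, f (of p I a) = g (of p I a))
    (hgamma : ∀ m x, f (gamma p I m x) = g (gamma p I m x)) : f = g := by
  refine Ideal.Quotient.ringHom_ext (RingHom.ext fun z => ?_)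
  induction z using DividedPowerAlgebra.induction_on with
  | C a => exact hof a
  | add x y hx hy => rw [map_add, map_add, hx, hy]
  | dp x n m hx => rw [map_mul, map_mul, hx]; exact congrArg _ (hgamma n m)

/-- The divided powers of the elements of `I` as exponential sequences. -/
def expGamma (x : I) : ExpSeries (PDHull p I) where
  coeff m := gamma p I m x
  coeff_zero := (congrArg _ DividedPowerAlgebra.dp_zero).trans (map_one _)
  coeff_mul_coeff m n := by
    refine (map_mul (Ideal.Quotient.mk (pdHullIdeal p I)) _ _).symm.trans ?_
    rw [DividedPowerAlgebra.dp_mul, nsmul_eq_mul, map_mul, map_natCast]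
    rfl

theorem expGamma_add (x y : I) : expGamma p I (x + y) = expGamma p I x + expGamma p I y := by
  ext n
  refine (congrArg (Ideal.Quotient.mk (pdHullIdeal p I)) DividedPowerAlgebra.dp_add).trans ?_
  rw [map_sum, ExpSeries.coeff_add]
  exact Finset.sum_congr rfl fun _ _ => map_mul _ _ _

theorem gamma_smul (m : ℕ) (a : A) (x : I) :
    gamma p I m (a • x) = of p I a ^ m * gamma p I m x := by
  refine (congrArg (Ideal.Quotient.mk (pdHullIdeal p I)) DividedPowerAlgebra.dp_smul).trans ?_
  rw [Algebra.smul_def, map_mul, map_pow, map_pow]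
  rfl

theorem den_mul_gamma (h : (p : A) ∈ I) (m : ℕ) :
    ((((p : ℚ) ^ m / (m.factorial : ℚ)).den : ℕ) : PDHull p I) * gamma p I m ⟨p, h⟩ =
      ((((p : ℚ) ^ m / (m.factorial : ℚ)).num : ℤ) : PDHull p I) := by
  rw [← sub_eq_zero]
  refine Eq.trans ?_ (Ideal.Quotient.eq_zero_iff_mem.2
    (Ideal.subset_span (Or.inr ⟨h, m, rfl⟩)) : Ideal.Quotient.mk (pdHullIdeal p I) _ = 0)
  rw [map_sub, map_mul, map_natCast, map_intCast]
  rfl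

/-- A ring homomorphism `ρ` from the PD hull defines a linear map to exponential sequences. -/
def expMap {R : Type*} [CommRing R] [Algebra A R] (ρ : PDHull p I →+* R)
    (hρ : ∀ a, ρ (of p I a) = algebraMap A R a) : I →ₗ[A] ExpSeries R where
  toFun x := (expGamma p I x).map ρ
  map_add' x y := by
    rw [expGamma_add]
    ext n
    change ρ ((expGamma p I x + expGamma p I y).coeff n) = _
    rw [ExpSeries.coeff_add, ExpSeries.coeff_add, map_sum]
    exact Finset.sum_congr rfl fun _ _ => map_mul _ _ _
  map_smul' a x := by
    ext n
    change ρ (gamma p I n (a • x)) = _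
    rw [gamma_smul, map_mul, map_pow, hρ]
    rfl

end PDHull

/-! ### `p`-adic completions -/

namespace PCompletion

variable (p : ℕ) {R S : Type*} [CommRing R] [CommRing S]

theorem exists_eq_of_add (n : ℕ) (x : PCompletion p R) :
    ∃ (r : R) (y : PCompletion p R), x = of p R r + (p : PCompletion p R) ^ n * y := by
  obtain ⟨r, hr⟩ := Ideal.Quotient.mk_surjective
    (AdicCompletion.evalₐ (Ideal.span {(p : R)}) n x)
  have hx : x - of p R r ∈ (AdicCompletion.eval (Ideal.span {(p : R)}) R n).ker := by
    have h0 : AdicCompletion.evalₐ (Ideal.span {(p : R)}) n (x - of p R r) = 0 := by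
      rw [map_sub, ← hr, sub_eq_zero]
      rfl
    have hinj : Function.Injective (Ideal.Quotient.factor
        (le_of_eq (Ideal.mul_top (Ideal.span {(p : R)} ^ n)))) := by
      simpa [RingHom.injective_iff_ker_eq_bot, Ideal.Quotient.factor_ker]
        using Ideal.map_mk_eq_bot_of_le (le_of_eq (Ideal.mul_top (Ideal.span {(p : R)} ^ n)).symm)
    rw [← AdicCompletion.factor_eval_eq_evalₐ] at h0
    · exact (map_eq_zero_iff _ hinj).1 h0
    · exact le_of_eq (Ideal.mul_top _)
  -- Since (p) is finitely generated, the kernel of evaluation modulo p^n is p^n times the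
  -- completion.
  rw [← AdicCompletion.pow_smul_top_eq_ker_eval (Submodule.fg_span_singleton _),
    Ideal.span_singleton_pow, Submodule.ideal_span_singleton_smul] at hx
  obtain ⟨y, -, hy⟩ := Submodule.mem_smul_pointwise_iff_exists _ _ _ |>.1 hx
  refine ⟨r, y, ?_⟩
  rw [Algebra.smul_def, map_pow, map_natCast] at hy
  rw [hy]
  ring

/-- The inverses modulo p^n are compatible because the maps themselves are, so they glue to a
preimage in the limit. -/
theorem lift_bijective (g : R →+* PCompletion p S)
    (hg : ∀ n, Function.Bijective (liftAux p g n)) : Function.Bijective (lift p g) := by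
  have hev : ∀ n x, AdicCompletion.evalₐ (Ideal.span {(p : S)}) n (lift p g x) =
      liftAux p g n (AdicCompletion.evalₐ (Ideal.span {(p : R)}) n x) := fun n x =>
    AdicCompletion.evalₐ_liftRingHom _ _ (factorPow_comp_liftAux p g) n x
  constructor
  · intro x y hxy
    refine AdicCompletion.ext_evalₐ fun n => (hg n).1 ?_
    rw [← hev, ← hev, hxy]
  · intro y
    let e := fun n => RingEquiv.ofBijective _ (hg n)
    have he : ∀ n z, liftAux p g n ((e n).symm z) = z := fun n z => (e n).apply_symm_apply z
    have hc : ∀ {m n : ℕ} (hle : m ≤ n),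
        (Ideal.Quotient.factorPow (Ideal.span {(p : R)}) hle).comp
          (((e n).symm : _ →+* _).comp
            (AdicCompletion.evalₐ (Ideal.span {(p : S)}) n).toRingHom) =
          (((e m).symm : _ →+* _).comp
            (AdicCompletion.evalₐ (Ideal.span {(p : S)}) m).toRingHom) := by
      intro m n hle
      ext z
      refine (hg m).1 ?_
      refine Eq.trans ?_ (he m _).symm
      change liftAux p g m (Ideal.Quotient.factorPow _ hle
        ((e n).symm (AdicCompletion.evalₐ _ n z))) = AdicCompletion.evalₐ _ m z
      obtain ⟨a, ha⟩ := Ideal.Quotient.mk_surjective ((e n).symm (AdicCompletion.evalₐ _ n z))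
      have h1 := RingHom.congr_fun (factorPow_comp_liftAux p g hle) (of p R a)
      have h2 : liftAux p g n (Ideal.Quotient.mk _ a) = AdicCompletion.evalₐ _ n z := by
        rw [ha]
        exact he n _
      rw [← ha, ← factorPow_evalₐ _ hle z, ← h2]
      exact h1.symm
    refine ⟨AdicCompletion.liftRingHom _ _ hc y, AdicCompletion.ext_evalₐ fun n => ?_⟩
    rw [hev]
    refine (congrArg _ (AdicCompletion.evalₐ_liftRingHom _ _ hc n y)).trans ?_
    exact he n _

end PCompletion

/-! ### Approximation in `W(C♭)` and vanishing modulo p^n -/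

theorem ExpSeries.smul_eq_zero {X Q : Type*} [CommRing X] [CommRing Q] [Algebra X Q] (p : ℕ)
    (a : ExpSeries Q)
    (ha : ∀ m, 0 < m → (p : Q) ∣ a.coeff m) (x : X)
    (hx : (p : Q) * algebraMap X Q x = 0) : x • a = 0 := by
  ext m
  rw [ExpSeries.coeff_smul, ExpSeries.coeff_zero_series]
  rcases Nat.eq_zero_or_pos m with rfl | hm
  · rw [if_pos rfl, pow_zero, one_mul, a.coeff_zero]
  · rw [if_neg hm.ne']
    obtain ⟨c, hc⟩ := ha m hm
    obtain ⟨m, rfl⟩ := Nat.exists_eq_succ_of_ne_zero hm.ne'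
    rw [hc, pow_succ]
    linear_combination algebraMap X Q x ^ m * c * hx

section Approximation

theorem PerfectRing.exists_pow_pow_eq {R : Type*} [CommRing R] (p : ℕ) [PerfectRing R p] (k : ℕ)
    (x : R) : ∃ y, y ^ p ^ k = x := by
  induction k with
  | zero => exact ⟨x, by rw [pow_zero, pow_one]⟩
  | succ k ih =>
    obtain ⟨y, rfl⟩ := ih
    obtain ⟨z, rfl⟩ := (PerfectRing.bijective_frobenius (R := R) (p := p)).2 y
    exact ⟨z, by rw [pow_succ', pow_mul]⟩

variable (p : ℕ) [Fact p.Prime]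

namespace Fontainization

variable {C : Type*} [CommRing C] [IsFpAlgebra p C]

instance : IsFpAlgebra p (Fontainization p C) where
  natCast_eq_zero := Subtype.ext (funext fun _ => IsFpAlgebra.natCast_eq_zero)

theorem proj_succ_pow (k : ℕ) (x : Fontainization p C) :
    proj p C (k + 1) x ^ p = proj p C k x := x.2 k

theorem proj_pow (k : ℕ) (x : Fontainization p C) : proj p C k x ^ p ^ k = proj p C 0 x := by
  induction k with
  | zero => rw [pow_zero, pow_one]
  | succ k ih => rw [pow_succ', pow_mul, proj_succ_pow, ih]

instance : PerfectRing (Fontainization p C) p where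
  bijective_frobenius := by
    constructor
    · intro x y h
      refine Subtype.ext (funext fun n => ?_)
      rw [← x.2 n, ← y.2 n]
      exact congrFun (congrArg Subtype.val h) (n + 1)
    · intro x
      refine ⟨⟨fun n => x.1 (n + 1), fun n => x.2 (n + 1)⟩, Subtype.ext (funext fun n => x.2 n)⟩

/-- Take the p^k-th root y of x in the perfect ring C♭; then ν_0(y) = ν_k(y^{p^k}). -/
theorem exists_pow_eq_of_proj_eq_zero (k : ℕ) (x : Fontainization p C)
    (hx : proj p C k x = 0) : ∃ y, y ^ p ^ k = x ∧ proj p C 0 y = 0 := by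
  obtain ⟨y, rfl⟩ := PerfectRing.exists_pow_pow_eq p k x
  exact ⟨y, rfl, by rw [← hx, map_pow, proj_pow]⟩

theorem proj_surjective [IsSemiperfect p C] (k : ℕ) : Function.Surjective (proj p C k) := by
  intro c
  choose r hr using IsSemiperfect.surjective_frobenius (p := p) (R := C)
  -- Below index k the entries are powers of c, above it iterated chosen p-th roots; truncated
  -- subtraction makes one of the two exponents 0.
  refine ⟨⟨fun n => r^[n - k] (c ^ p ^ (k - n)), fun n => ?_⟩, ?_⟩
  · dsimp only
    rcases Nat.lt_or_ge n k with h | h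
    · rw [Nat.sub_eq_zero_of_le h, Nat.sub_eq_zero_of_le h.le,
        show k - n = k - (n + 1) + 1 by omega, pow_succ, pow_mul]
      rfl
    · rw [Nat.sub_eq_zero_of_le h, Nat.sub_eq_zero_of_le (h.trans n.le_succ), Nat.succ_sub h,
        Function.iterate_succ_apply']
      exact hr _
  · change r^[k - k] (c ^ p ^ (k - k)) = c
    rw [Nat.sub_self, pow_zero, pow_one]
    rfl

end Fontainization

open Fontainization

section NearZero

variable {C : Type*} [CommRing C] [IsFpAlgebra p C]

/-- The kernel of the homomorphism `W(C♭) → W_n(C)` induced by `ν_k`. -/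
def nearZero (C : Type*) [CommRing C] [IsFpAlgebra p C] (n k : ℕ) :
    Ideal (WittVector p (Fontainization p C)) :=
  (RingHom.ker (WittVector.truncate (p := p) n)).comap (WittVector.map (proj p C k))

theorem mem_nearZero {n k : ℕ} {x : WittVector p (Fontainization p C)} :
    x ∈ nearZero p C n k ↔ ∀ i < n, proj p C k (x.coeff i) = 0 := by
  rw [nearZero, Ideal.mem_comap, WittVector.mem_ker_truncate]
  rfl

theorem nearZero_zero (k : ℕ) (x : WittVector p (Fontainization p C)) : x ∈ nearZero p C 0 k :=
  (mem_nearZero p).2 fun _ h => absurd h (Nat.not_lt_zero _)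

/-- Multiplying by p shifts coefficients by one and raises them to the p-th power, and p-th powers
turn ν_{k+1} into ν_k. So dividing by p costs one coefficient and one level. -/
theorem natCast_mul_mem_nearZero {n k : ℕ} {x : WittVector p (Fontainization p C)} :
    (p : WittVector p (Fontainization p C)) * x ∈ nearZero p C (n + 1) (k + 1) ↔
      x ∈ nearZero p C n k := by
  rw [mem_nearZero, mem_nearZero]
  constructor
  · intro h i hi
    have := h (i + 1) (Nat.succ_lt_succ hi)
    rwa [WittVector.coeff_succ_natCast_mul, map_pow, proj_succ_pow] at this
  · rintro h (_ | i) hi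
    · rw [WittVector.coeff_zero_natCast_mul, map_zero]
    · rw [WittVector.coeff_succ_natCast_mul, map_pow, proj_succ_pow]
      exact h i (Nat.lt_of_succ_lt_succ hi)

/-- Modulo p, x is the Teichmüller lift of x_0, so modulo p^{k+1} its p^k-th power is the lift of
x_0^{p^k}, which ν_k kills. Multiples of p^{k+1} have zero coefficients below k + 1. -/
theorem pow_mem_nearZero {n k : ℕ} (hnk : n ≤ k + 1) {x : WittVector p (Fontainization p C)}
    (hx : proj p C 0 (x.coeff 0) = 0) : x ^ p ^ k ∈ nearZero p C n k := by
  obtain ⟨w, hw⟩ := WittVector.exists_eq_teichmuller_add p x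
  obtain ⟨d, hd⟩ := dvd_sub_pow_of_dvd_sub (p := p)
    (a := x) (b := WittVector.teichmuller p (x.coeff 0)) ⟨w, sub_eq_iff_eq_add'.2 hw⟩ k
  rw [sub_eq_iff_eq_add'] at hd
  rw [hd]
  refine Ideal.add_mem _ ?_ ?_
  · rw [mem_nearZero, ← map_pow]
    intro i _
    rcases Nat.eq_zero_or_pos i with rfl | hi
    · rw [WittVector.teichmuller_coeff_zero, map_pow, proj_pow, hx]
    · rw [WittVector.teichmuller_coeff_pos _ _ _ hi, map_zero]
  · rw [mem_nearZero]
    intro i hi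
    rw [WittVector.coeff_natCast_pow_mul p d (hi.trans_le hnk), map_zero]

end NearZero

theorem pow_dvd_factorial_mul (n : ℕ) : p ^ n ∣ (n * p).factorial := by
  induction n with
  | zero => simp
  | succ n ih =>
    rw [pow_succ, Nat.succ_mul]
    exact (mul_dvd_mul ih (Nat.dvd_factorial (Fact.out : p.Prime).pos le_rfl)).trans
      (Nat.factorial_mul_factorial_dvd_factorial_add _ _)

/-- A ring `X` over `W(C♭)` and an `X`-module `M → X` that play the role of `W(C♭)` and of the
kernel of `W(C♭) → C`. -/
structure KernelModel (C : Type*) [CommRing C] [IsFpAlgebra p C] (X M : Type*) [CommRing X]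
    [AddCommGroup M] [Module X M] where
  g : X →+* WittVector p (Fontainization p C)
  ι : M →ₗ[X] X
  pElt : M
  ι_pElt : ι pElt = p
  wittToBase_ι : ∀ u, wittToBase p C (g (ι u)) = 0
  mem_range : ∀ x, wittToBase p C (g x) = 0 → ∃ u, ι u = x
  -- The decomposition is required in M, not only after ι: exponential series will be attached to
  -- elements of M, and ι is not assumed injective.
  exists_eq : ∀ k u, proj p C k ((g (ι u)).coeff 0) = 0 →
    ∃ (e : M) (w : X), u = ι e ^ (p ^ k - 1) • e + w • pElt

namespace KernelModel

variable {p} {C : Type*} [CommRing C] [IsFpAlgebra p C] {X M : Type*} [CommRing X]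
  [AddCommGroup M] [Module X M] (K : KernelModel p C X M)

include K in
theorem exists_eq_pow_add (k : ℕ) (x : X) (hx : proj p C k ((K.g x).coeff 0) = 0) :
    ∃ e w, x = K.ι e ^ p ^ k + p * w := by
  obtain ⟨u, rfl⟩ := K.mem_range x (by
    change proj p C 0 ((K.g x).coeff 0) = 0
    rw [← proj_pow p k, hx, zero_pow (pow_pos (Fact.out : p.Prime).pos k).ne'])
  obtain ⟨e, w, hew⟩ := K.exists_eq k u hx
  refine ⟨e, w, ?_⟩
  conv_lhs => rw [hew]
  rw [map_add, map_smul, map_smul, smul_eq_mul, smul_eq_mul, K.ι_pElt, ← pow_succ,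
    Nat.sub_add_cancel (pow_pos (Fact.out : p.Prime).pos k), mul_comm w]

variable {Q : Type*} [CommRing Q] [Algebra X Q] (E : M →ₗ[X] ExpSeries Q)
  (h1 : ∀ u, (E u).coeff 1 = algebraMap X Q (K.ι u)) {n : ℕ} (hn : (p : Q) ^ n = 0)

include h1 hn in
theorem pow_eq_zero (u : M) {N : ℕ} (hN : n * p ≤ N) : algebraMap X Q (K.ι u) ^ N = 0 := by
  refine pow_eq_zero_of_le hN ?_
  obtain ⟨c, hc⟩ := pow_dvd_factorial_mul p n
  rw [← h1, ExpSeries.coeff_one_pow, hc]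
  push_cast
  rw [hn, zero_mul, zero_mul]

-- Induction on i: the element is ι(e)^{p^k} + p w. The power dies in Q because p^k ≥ np, and w is
-- near zero with one coefficient and one level less. The summand np in the level keeps p^k large
-- enough throughout.
include h1 hn in
theorem pow_dvd_of_mem_nearZero {i : ℕ} (x : X)
    (hx : K.g x ∈ nearZero p C i (n * p + i)) : (p : Q) ^ i ∣ algebraMap X Q x := by
  induction i generalizing x with
  | zero => rw [pow_zero]; exact one_dvd _
  | succ i ih =>
    obtain ⟨e, w, rfl⟩ := K.exists_eq_pow_add _ x ((mem_nearZero p).1 hx 0 i.succ_pos)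
    have hw : K.g w ∈ nearZero p C i (n * p + i) := by
      rw [← natCast_mul_mem_nearZero]
      have h := pow_mem_nearZero p (n := i + 1) (k := n * p + (i + 1)) (by omega)
        (K.wittToBase_ι e)
      rw [map_add, map_pow, map_mul, map_natCast] at hx
      exact (Ideal.add_mem_iff_right _ h).1 hx
    rw [map_add, map_pow, K.pow_eq_zero E h1 hn e
      ((Nat.le_add_right _ _).trans (Nat.lt_pow_self (Fact.out : p.Prime).one_lt).le), zero_add,
      map_mul, map_natCast, pow_succ']
    exact mul_dvd_mul_left _ (ih w hw)

-- One coefficient and one level are spent on splitting off w • `pElt`; the remaining n give p^n ∣ w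
-- in Q. The other term has the scalar ι(e)^{p^k-1}, which vanishes in Q because np ≤ p^k - 1.
include h1 hn in
theorem exp_eq_zero_of_mem_nearZero (hp : ∀ m, 0 < m → (p : Q) ∣ (E K.pElt).coeff m) (u : M)
    (hu : K.g (K.ι u) ∈ nearZero p C (n + 1) (n * p + (n + 1))) : E u = 0 := by
  obtain ⟨e, w, hew⟩ := K.exists_eq _ u ((mem_nearZero p).1 hu 0 n.succ_pos)
  have hpk : 0 < p ^ (n * p + (n + 1)) := pow_pos (Fact.out : p.Prime).pos _
  have hw : K.g w ∈ nearZero p C n (n * p + n) := by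
    rw [← natCast_mul_mem_nearZero]
    have h := pow_mem_nearZero p (n := n + 1) (k := n * p + (n + 1)) (by omega)
      (K.wittToBase_ι e)
    rw [hew, map_add, map_smul, map_smul, smul_eq_mul, smul_eq_mul, K.ι_pElt, ← pow_succ,
      Nat.sub_add_cancel hpk, map_add, map_pow, mul_comm w, map_mul,
      map_natCast] at hu
    exact (Ideal.add_mem_iff_right _ h).1 hu
  have hpw : (p : Q) * algebraMap X Q w = 0 := by
    obtain ⟨c, hc⟩ := K.pow_dvd_of_mem_nearZero E h1 hn w hw
    rw [hc, hn, zero_mul, mul_zero]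
  rw [hew, map_add, map_smul, map_smul, ExpSeries.smul_eq_zero p _ hp w hpw, add_zero]
  ext m
  rw [ExpSeries.coeff_smul, ExpSeries.coeff_zero_series, map_pow, K.pow_eq_zero E h1 hn e]
  · rcases Nat.eq_zero_or_pos m with rfl | hm
    · rw [if_pos rfl, pow_zero, one_mul, (E e).coeff_zero]
    · rw [if_neg hm.ne', zero_pow hm.ne', zero_mul]
  · exact Nat.le_sub_one_of_lt ((Nat.le_add_right _ _).trans_lt
      (Nat.lt_pow_self (Fact.out : p.Prime).one_lt))

/-- Successive approximation: match the zeroth coefficient under ν_{j+n+1}. The error is then a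
p^{j+n+1}-th power of a Teichmüller lift, which is near zero, plus p w, and w is approximated by
induction. -/
theorem exists_sub_mem_nearZero
    (hg : ∀ k, Function.Surjective fun x => proj p C k ((K.g x).coeff 0)) (n j : ℕ)
    (y : WittVector p (Fontainization p C)) : ∃ x, y - K.g x ∈ nearZero p C n (j + n) := by
  induction n generalizing y with
  | zero => exact ⟨0, nearZero_zero p _ _⟩
  | succ n ih =>
    obtain ⟨x, hx⟩ := hg (j + (n + 1)) (proj p C (j + (n + 1)) (y.coeff 0))
    dsimp only at hx
    have h0 : proj p C (j + (n + 1)) ((y - K.g x).coeff 0) = 0 := by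
      change proj p C (j + (n + 1)) (WittVector.constantCoeff (y - K.g x)) = 0
      rw [map_sub, map_sub, sub_eq_zero]
      exact hx.symm
    obtain ⟨d, hd, hd0⟩ := exists_pow_eq_of_proj_eq_zero p _ _ h0
    obtain ⟨w, hw⟩ := WittVector.exists_eq_teichmuller_add p (y - K.g x)
    obtain ⟨x', hx'⟩ := ih w
    refine ⟨x + p * x', ?_⟩
    have h : y - K.g (x + p * x') = WittVector.teichmuller p d ^ p ^ (j + (n + 1)) +
        p * (w - K.g x') := by
      rw [← map_pow, hd, map_add, map_mul, map_natCast]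
      linear_combination hw
    rw [h]
    exact Ideal.add_mem _ (pow_mem_nearZero p (by omega) hd0)
      ((natCast_mul_mem_nearZero p).2 hx')

/-- An approximant of an element of the kernel is itself in the kernel, since closeness forces
equality under ν_0. -/
theorem exists_sub_ι_mem_nearZero
    (hg : ∀ k, Function.Surjective fun x => proj p C k ((K.g x).coeff 0)) (n j : ℕ)
    (y : WittVector p (Fontainization p C)) (hy : wittToBase p C y = 0) :
    ∃ u, y - K.g (K.ι u) ∈ nearZero p C (n + 1) (j + (n + 1)) := by
  obtain ⟨x, hx⟩ := K.exists_sub_mem_nearZero hg (n + 1) j y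
  obtain ⟨u, rfl⟩ := K.mem_range x (by
    have h0 := (mem_nearZero p).1 hx 0 n.succ_pos
    have h1 : wittToBase p C (y - K.g x) = 0 := by
      change proj p C 0 ((y - K.g x).coeff 0) = 0
      rw [← proj_pow p, h0, zero_pow (pow_pos (Fact.out : p.Prime).pos _).ne']
    rwa [map_sub, hy, zero_sub, neg_eq_zero] at h1)
  exact ⟨u, hx⟩

end KernelModel

/-- `W(C♭)` and the kernel of `W(C♭) → C`. -/
def kernelModelSelf (C : Type*) [CommRing C] [IsFpAlgebra p C] :
    KernelModel p C (WittVector p (Fontainization p C)) (RingHom.ker (wittToBase p C)) where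
  g := RingHom.id _
  ι := (RingHom.ker (wittToBase p C)).subtype
  pElt := ⟨p, by rw [RingHom.mem_ker, map_natCast, IsFpAlgebra.natCast_eq_zero]⟩
  ι_pElt := rfl
  wittToBase_ι u := u.2
  mem_range x hx := ⟨⟨x, hx⟩, rfl⟩
  exists_eq k u hu := by
    obtain ⟨y, hy, hy0⟩ := exists_pow_eq_of_proj_eq_zero p k _ hu
    obtain ⟨w, hw⟩ := WittVector.exists_eq_teichmuller_add p
      (u : WittVector p (Fontainization p C))
    refine ⟨⟨WittVector.teichmuller p y, hy0⟩, w, Subtype.ext ?_⟩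
    change (u : WittVector p (Fontainization p C)) =
      WittVector.teichmuller p y ^ (p ^ k - 1) * WittVector.teichmuller p y + w * p
    rw [← pow_succ, Nat.sub_add_cancel (pow_pos (Fact.out : p.Prime).pos k), ← map_pow, hy,
      mul_comm w]
    exact hw

end Approximation

/-! ### `W(P) ⊗ W(B')` modulo p, and the use of flatness -/

section WittTensor

variable (p : ℕ) [Fact p.Prime] (B B' P : Type*) [CommRing B] [CommRing B'] [CommRing P]
  [Algebra B B'] [Algebra B P]

/-- The ring `W(P) ⊗_{W(B)} W(B')`. -/
abbrev WittTensor := WittVector p P ⊗[WittVector p B] WittVector p B'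

namespace WittTensor

/-- The homomorphism `W(P) ⊗_{W(B)} W(B') → P ⊗_B B'` given by the zeroth coefficients. -/
def coeffZero : WittTensor p B B' P →+* P ⊗[B] B' :=
  letI : Algebra (WittVector p B) (P ⊗[B] B') :=
    ((algebraMap B (P ⊗[B] B')).comp WittVector.constantCoeff).toAlgebra
  (Algebra.TensorProduct.lift (R := WittVector p B) (S := WittVector p B)
    ({ (Algebra.TensorProduct.includeLeft : P →ₐ[B] P ⊗[B] B').toRingHom.comp
          WittVector.constantCoeff with
        commutes' := fun _ => rfl } : WittVector p P →ₐ[WittVector p B] P ⊗[B] B')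
    ({ (Algebra.TensorProduct.includeRight : B' →ₐ[B] P ⊗[B] B').toRingHom.comp
          WittVector.constantCoeff with
        commutes' := fun x =>
          (Algebra.TensorProduct.includeRight : B' →ₐ[B] P ⊗[B] B').commutes (x.coeff 0) } :
      WittVector p B' →ₐ[WittVector p B] P ⊗[B] B')
    (fun _ _ => Commute.all _ _)).toRingHom

theorem coeffZero_tmul (x : WittVector p P) (y : WittVector p B') :
    coeffZero p B B' P (x ⊗ₜ y) = x.coeff 0 ⊗ₜ y.coeff 0 := by
  refine (Algebra.TensorProduct.tmul_mul_tmul _ _ _ _).trans ?_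
  rw [mul_one, one_mul]
  rfl

variable {B' P} in
theorem map_teichmuller_smul_tmul (r : B) (x : P) (b : B') :
    (WittVector.teichmuller p (r • x) ⊗ₜ[WittVector p B] WittVector.teichmuller p b :
      WittTensor p B B' P) = WittVector.teichmuller p x ⊗ₜ WittVector.teichmuller p (r • b) := by
  rw [Algebra.smul_def, Algebra.smul_def, map_mul, map_mul, ← WittVector.map_teichmuller,
    ← WittVector.map_teichmuller]
  exact TensorProduct.smul_tmul (R := WittVector p B) (WittVector.teichmuller p r) _ _

variable (I : Ideal (WittVector p P))

/-- The inclusion of `I` in `W(P)` after base change. -/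
def incl : WittTensor p B B' P ⊗[WittVector p P] I →ₗ[WittTensor p B B' P] WittTensor p B B' P :=
  LinearMap.liftBaseChange (WittTensor p B B' P)
    ((Algebra.linearMap (WittVector p P) (WittTensor p B B' P)).comp I.subtype)

theorem incl_tmul (z : WittTensor p B B' P) (x : I) :
    incl p B B' P I (z ⊗ₜ x) = z * ((x : WittVector p P) ⊗ₜ 1) := rfl

variable {p B B' P} {I}
variable (J : Ideal P) (hI : ∀ x, x ∈ I ↔ x.coeff 0 ∈ J)

section

variable (hp : (p : WittVector p P) ∈ I)

/-- The submodule generated by the class of `p`. -/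
def pSpan : Submodule (WittTensor p B B' P) (WittTensor p B B' P ⊗[WittVector p P] I) :=
  Submodule.span _ {1 ⊗ₜ ⟨p, hp⟩}

theorem tmul_mem_pSpan (z : WittTensor p B B' P) : z ⊗ₜ ⟨p, hp⟩ ∈ pSpan (B := B) (B' := B') hp := by
  refine Submodule.mem_span_singleton.2 ⟨z, ?_⟩
  rw [TensorProduct.smul_tmul', smul_eq_mul, mul_one]

theorem tmul_smul_mem_pSpan (z : WittTensor p B B' P) (w : WittVector p P) :
    z ⊗ₜ (w • ⟨p, hp⟩) ∈ pSpan (B := B) (B' := B') hp := by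
  rw [← TensorProduct.smul_tmul]
  exact tmul_mem_pSpan hp _

/-- As p lies in I, the element p·x of I is also the multiple x • p of the generator, so p moves
across the tensor sign. -/
theorem natCast_mul_tmul_mem_pSpan (z : WittTensor p B B' P) (x : I) :
    (p * z) ⊗ₜ x ∈ pSpan (B := B) (B' := B') hp := by
  have h : ((p : WittTensor p B B' P) * z) ⊗ₜ[WittVector p P] x =
      z ⊗ₜ ((x : WittVector p P) • (⟨p, hp⟩ : I)) := by
    have h1 : (p : WittTensor p B B' P) * z = (p : WittVector p P) • z := by
      rw [Algebra.smul_def, map_natCast]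
    rw [h1, TensorProduct.smul_tmul]
    congr 1
    exact Subtype.ext (mul_comm _ _)
  rw [h]
  exact tmul_smul_mem_pSpan hp _ _

theorem coeffZero_incl_of_mem_pSpan [IsFpAlgebra p P] {u : WittTensor p B B' P ⊗[WittVector p P] I}
    (hu : u ∈ pSpan (B := B) (B' := B') hp) :
    coeffZero p B B' P (incl p B B' P I u) = 0 := by
  obtain ⟨z, rfl⟩ := Submodule.mem_span_singleton.1 hu
  have h : ((p : WittVector p P) ⊗ₜ[WittVector p B] (1 : WittVector p B') :
      WittTensor p B B' P) = p := by
    exact map_natCast (algebraMap (WittVector p P) (WittTensor p B B' P)) p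
  rw [map_smul, incl_tmul, one_mul, h, smul_eq_mul, map_mul, map_natCast,
    IsFpAlgebra.natCast_eq_zero, mul_zero]

/-- The class of `[b] ⊗ [x]` modulo `p`. -/
def teichmullerTmul (x : J) (b : B') :
    (WittTensor p B B' P ⊗[WittVector p P] I) ⧸ pSpan (B := B) (B' := B') hp :=
  Submodule.Quotient.mk ((1 ⊗ₜ WittVector.teichmuller p b) ⊗ₜ
    ⟨WittVector.teichmuller p (x : P), (hI _).2 x.2⟩)

theorem teichmullerTmul_add [IsFpAlgebra p B'] [PerfectRing B' p] (x : J) (b c : B') :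
    teichmullerTmul (B := B) J hI hp x (b + c) =
      teichmullerTmul J hI hp x b + teichmullerTmul J hI hp x c := by
  obtain ⟨w, hw⟩ := WittVector.exists_teichmuller_add p b c
  have h : ((1 : WittVector p P) ⊗ₜ[WittVector p B] WittVector.teichmuller p (b + c) :
      WittTensor p B B' P) = 1 ⊗ₜ WittVector.teichmuller p b +
        1 ⊗ₜ WittVector.teichmuller p c + (p : WittTensor p B B' P) * (1 ⊗ₜ w) := by
    rw [hw, TensorProduct.tmul_add, TensorProduct.tmul_add, ← nsmul_eq_mul, ← nsmul_eq_mul,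
      TensorProduct.tmul_smul]
  rw [teichmullerTmul, h, TensorProduct.add_tmul, TensorProduct.add_tmul,
    Submodule.Quotient.mk_add, Submodule.Quotient.mk_add, (Submodule.Quotient.mk_eq_zero _).2
      (natCast_mul_tmul_mem_pSpan hp _ _), add_zero]
  rfl

/-- The failure of additivity is p w with w not necessarily in I. It need not lie in p I, but it is
w times the element p of I; this is why the quotient is by the class of p. -/
theorem add_teichmullerTmul [IsFpAlgebra p P] [PerfectRing P p] (x y : J) (b : B') :
    teichmullerTmul (B := B) J hI hp (x + y) b =
      teichmullerTmul J hI hp x b + teichmullerTmul J hI hp y b := by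
  obtain ⟨w, hw⟩ := WittVector.exists_teichmuller_add p (x : P) (y : P)
  have h : (⟨WittVector.teichmuller p ((x + y : J) : P), (hI _).2 (x + y).2⟩ : I) =
      ⟨WittVector.teichmuller p (x : P), (hI _).2 x.2⟩ +
        ⟨WittVector.teichmuller p (y : P), (hI _).2 y.2⟩ + w • ⟨p, hp⟩ :=
    Subtype.ext (hw.trans (congrArg _ (mul_comm _ _)))
  rw [teichmullerTmul, h, TensorProduct.tmul_add, TensorProduct.tmul_add,
    Submodule.Quotient.mk_add, Submodule.Quotient.mk_add, (Submodule.Quotient.mk_eq_zero _).2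
      (tmul_smul_mem_pSpan hp _ _), add_zero]
  rfl

theorem smul_teichmullerTmul (r : B) (x : J) (b : B') :
    teichmullerTmul (B := B) J hI hp (r • x) b = teichmullerTmul J hI hp x (r • b) := by
  have h1 : (⟨WittVector.teichmuller p ((r • x : J) : P), (hI _).2 (r • x).2⟩ : I) =
      WittVector.teichmuller p (algebraMap B P r) •
        ⟨WittVector.teichmuller p (x : P), (hI _).2 x.2⟩ := by
    refine Subtype.ext ?_
    change WittVector.teichmuller p (r • (x : P)) = _ * _
    rw [Algebra.smul_def, map_mul]
  have h2 : ((1 : WittVector p P) ⊗ₜ[WittVector p B] WittVector.teichmuller p (r • b) :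
      WittTensor p B B' P) = WittVector.teichmuller p (algebraMap B P r) •
        (1 ⊗ₜ WittVector.teichmuller p b) := by
    have h := map_teichmuller_smul_tmul p B r (1 : P) b
    rw [map_one] at h
    rw [← h, TensorProduct.smul_tmul', smul_eq_mul, mul_one, Algebra.smul_def, mul_one]
  rw [teichmullerTmul, teichmullerTmul, h1, h2, TensorProduct.smul_tmul]

variable [IsFpAlgebra p B'] [IsFpAlgebra p P] [PerfectRing B' p] [PerfectRing P p]

/-- The homomorphism `x ⊗ b ↦ [b] ⊗ [x]` modulo `p`. -/
def teichmullerTensor : J ⊗[B] B' →+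
    (WittTensor p B B' P ⊗[WittVector p P] I) ⧸ pSpan (B := B) (B' := B') hp :=
  TensorProduct.liftAddHom
    (AddMonoidHom.mk' (fun x => AddMonoidHom.mk' (fun b => teichmullerTmul J hI hp x b)
        (teichmullerTmul_add J hI hp x))
      (fun x y => AddMonoidHom.ext fun b => add_teichmullerTmul J hI hp x y b))
    (fun r x b => smul_teichmullerTmul J hI hp r x b)

theorem teichmullerTensor_tmul (x : J) (b : B') :
    teichmullerTensor J hI hp (x ⊗ₜ[B] b) = Submodule.Quotient.mk
      ((1 ⊗ₜ WittVector.teichmuller p b) ⊗ₜ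
        ⟨WittVector.teichmuller p (x : P), (hI _).2 x.2⟩) := rfl

/-- In (a ⊗ y) ⊗ x the factor a is absorbed into x; then y and a x may be replaced by the
Teichmüller lifts of their zeroth coefficients modulo the class of p. -/
theorem teichmullerTensor_surjective :
    Function.Surjective (teichmullerTensor (B := B) (B' := B') J hI hp) := by
  suffices h : ∀ u : WittTensor p B B' P ⊗[WittVector p P] I,
      Submodule.Quotient.mk u ∈ (teichmullerTensor (B := B) (B' := B') J hI hp).range by
    intro q
    obtain ⟨u, rfl⟩ := Submodule.Quotient.mk_surjective _ q
    exact h u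
  intro u
  induction u with
  | zero => exact zero_mem _
  | add u v hu hv => exact add_mem hu hv
  | tmul z x =>
    induction z using TensorProduct.induction_on with
    | zero => rw [TensorProduct.zero_tmul]; exact zero_mem _
    | add z z' hz hz' => rw [TensorProduct.add_tmul]; exact add_mem hz hz'
    | tmul a y =>
      obtain ⟨x', hx'⟩ : ∃ x' : I, a • x = x' := ⟨_, rfl⟩
      have h1 : (a ⊗ₜ[WittVector p B] y : WittTensor p B B' P) ⊗ₜ[WittVector p P] x =
          ((1 : WittVector p P) ⊗ₜ y) ⊗ₜ x' := by
        rw [← hx', ← TensorProduct.smul_tmul, TensorProduct.smul_tmul', smul_eq_mul, mul_one]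
      obtain ⟨c, hc⟩ := WittVector.exists_eq_teichmuller_add p (x' : WittVector p P)
      obtain ⟨d, hd⟩ := WittVector.exists_eq_teichmuller_add p y
      have hx0 := (hI _).1 x'.2
      have h2 : x' = ⟨WittVector.teichmuller p ((x' : WittVector p P).coeff 0),
          (hI _).2 hx0⟩ + c • ⟨p, hp⟩ :=
        Subtype.ext (hc.trans (congrArg _ (mul_comm _ _)))
      have h3 : ((1 : WittVector p P) ⊗ₜ[WittVector p B] y : WittTensor p B B' P) =
          1 ⊗ₜ WittVector.teichmuller p (y.coeff 0) + (p : WittTensor p B B' P) * (1 ⊗ₜ d) := by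
        conv_lhs => rw [hd]
        rw [TensorProduct.tmul_add, ← nsmul_eq_mul, ← nsmul_eq_mul, TensorProduct.tmul_smul]
      refine ⟨⟨_, hx0⟩ ⊗ₜ[B] y.coeff 0, ?_⟩
      rw [teichmullerTensor_tmul, h1, h3, TensorProduct.add_tmul, Submodule.Quotient.mk_add,
        (Submodule.Quotient.mk_eq_zero _).2 (natCast_mul_tmul_mem_pSpan hp _ _), add_zero]
      conv_rhs => rw [h2]
      rw [TensorProduct.tmul_add, Submodule.Quotient.mk_add, (Submodule.Quotient.mk_eq_zero _).2
          (tmul_smul_mem_pSpan hp _ _), add_zero]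

/-- The composite J ⊗ B' → M/[p] → P ⊗ B' is the base change of the inclusion J ⊆ P, expressed
through representatives u. -/
theorem coeffZero_incl_of_mk_eq (u : WittTensor p B B' P ⊗[WittVector p P] I) (t : J ⊗[B] B')
    (h : Submodule.Quotient.mk u = teichmullerTensor J hI hp t) :
    coeffZero p B B' P (incl p B B' P I u) =
      LinearMap.rTensor B' ((J.subtype).restrictScalars B) t := by
  induction t generalizing u with
  | zero =>
    rw [map_zero, Submodule.Quotient.mk_eq_zero] at h
    rw [map_zero, coeffZero_incl_of_mem_pSpan hp h]
  | add t t' ht ht' =>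
    obtain ⟨v, hv⟩ := Submodule.Quotient.mk_surjective _ (teichmullerTensor J hI hp t)
    rw [map_add, ← sub_eq_iff_eq_add', ← hv, ← Submodule.Quotient.mk_sub] at h
    rw [map_add, ← ht v hv, ← ht' _ h, map_sub, map_sub, add_sub_cancel]
  | tmul x b =>
    rw [teichmullerTensor_tmul, Submodule.Quotient.eq] at h
    have h' := coeffZero_incl_of_mem_pSpan hp h
    rw [map_sub, map_sub, sub_eq_zero] at h'
    rw [h', incl_tmul, Algebra.TensorProduct.tmul_mul_tmul, one_mul, mul_one, coeffZero_tmul]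
    rfl

-- Right exactness: the kernel of P ⊗ B' → D ⊗ B' is the image of J ⊗ B'.
include hI hp in
theorem coeffZero_mem_range {D : Type*} [CommRing D] [Algebra B D]
    (θ : P →ₐ[B] D) (hθ : Function.Surjective θ) (hker : ∀ x, θ x = 0 ↔ x ∈ J)
    (z : WittTensor p B B' P)
    (hz : Algebra.TensorProduct.map θ (AlgHom.id B B') (coeffZero p B B' P z) = 0) :
    ∃ u, coeffZero p B B' P (incl p B B' P I u) = coeffZero p B B' P z := by
  have hex : Function.Exact ((J.subtype).restrictScalars B) θ.toLinearMap := fun x =>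
    (hker x).trans ⟨fun h => ⟨⟨x, h⟩, rfl⟩, by rintro ⟨y, rfl⟩; exact y.2⟩
  obtain ⟨t, ht⟩ := (rTensor_exact B' hex hθ (coeffZero p B B' P z)).1 hz
  obtain ⟨q, hq⟩ := Submodule.Quotient.mk_surjective _
    (teichmullerTensor (B := B) (B' := B') J hI hp t)
  exact ⟨q, (coeffZero_incl_of_mk_eq J hI hp q t hq).trans ht⟩

variable [Module.Flat B B']

-- Here flatness enters: u comes modulo [p] from some t in J ⊗ B', and t vanishes because its image
-- in P ⊗ B' does and J ⊗ B' → P ⊗ B' is injective.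
include hI in
theorem exists_eq_smul_of_coeffZero_incl (u : WittTensor p B B' P ⊗[WittVector p P] I)
    (hu : coeffZero p B B' P (incl p B B' P I u) = 0) :
    ∃ z : WittTensor p B B' P, u = z • (1 ⊗ₜ ⟨p, hp⟩) := by
  obtain ⟨t, ht⟩ := teichmullerTensor_surjective (B := B) (B' := B') J hI hp
    (Submodule.Quotient.mk u)
  have h := coeffZero_incl_of_mk_eq J hI hp u t ht.symm
  rw [hu] at h
  have hinj := Module.Flat.rTensor_preserves_injective_linearMap (M := B')
    ((J.subtype).restrictScalars B) Subtype.val_injective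
  rw [← map_zero (LinearMap.rTensor B' ((J.subtype).restrictScalars B))] at h
  rw [← hinj h, map_zero, eq_comm, Submodule.Quotient.mk_eq_zero] at ht
  obtain ⟨z, hz⟩ := Submodule.mem_span_singleton.1 ht
  exact ⟨z, hz.symm⟩

end

variable [IsFpAlgebra p B'] [IsFpAlgebra p P] [PerfectRing B' p] [PerfectRing P p]
  [Module.Flat B B']

theorem exists_eq_mul_of_coeffZero (z : WittTensor p B B' P)
    (hz : coeffZero p B B' P z = 0) : ∃ w, z = p * w := by
  -- With I the unit ideal, M is the ring itself and the class of p is p.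
  obtain ⟨w, hw⟩ := exists_eq_smul_of_coeffZero_incl (I := ⊤) ⊤ (by simp) trivial
    (z ⊗ₜ ⟨1, trivial⟩) (by
      rw [incl_tmul]
      exact (congrArg _ (mul_one z)).trans hz)
  have h := congrArg (incl p B B' P ⊤) hw
  rw [map_smul, incl_tmul, incl_tmul, one_mul, smul_eq_mul] at h
  refine ⟨w, ((mul_one z).symm.trans h).trans ((mul_comm _ _).trans (congrArg (· * w) ?_))⟩
  exact map_natCast (algebraMap (WittVector p P) (WittTensor p B B' P)) p

theorem exists_eq_pow_add (k : ℕ) (z : WittTensor p B B' P) : ∃ y w, z = y ^ p ^ k + p * w := by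
  induction z using TensorProduct.induction_on with
  | zero => exact ⟨0, 0, by rw [zero_pow (pow_pos (Fact.out : p.Prime).pos k).ne']; simp⟩
  | add z z' hz hz' =>
    obtain ⟨y, w, rfl⟩ := hz
    obtain ⟨y', w', rfl⟩ := hz'
    obtain ⟨r, hr⟩ := exists_add_pow_prime_pow_eq (Fact.out : p.Prime) y y' k
    exact ⟨y + y', w + w' - y * y' * r, by rw [hr]; ring⟩
  | tmul a y =>
    obtain ⟨α, hα⟩ := PerfectRing.exists_pow_pow_eq p k (a.coeff 0)
    obtain ⟨β, hβ⟩ := PerfectRing.exists_pow_pow_eq p k (y.coeff 0)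
    obtain ⟨w, hw⟩ := exists_eq_mul_of_coeffZero (a ⊗ₜ[WittVector p B] y -
        (WittVector.teichmuller p α ⊗ₜ WittVector.teichmuller p β) ^ p ^ k) (by
      rw [map_sub, map_pow, coeffZero_tmul, coeffZero_tmul, WittVector.teichmuller_coeff_zero,
        WittVector.teichmuller_coeff_zero, Algebra.TensorProduct.tmul_pow, hα, hβ, sub_self])
    exact ⟨_, w, sub_eq_iff_eq_add'.1 hw⟩

end WittTensor

end WittTensor

/-! ### The kernel model for `C ⊗_B B'` -/

section BaseChangeModel

variable (p : ℕ) [Fact p.Prime]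

/-- If `B` is perfect and `C` is a `B`-algebra, then `C♭` is a `B`-algebra. -/
instance Fontainization.algebra (B C : Type*) [CommRing B] [CommRing C] [IsFpAlgebra p B]
    [IsFpAlgebra p C] [PerfectRing B p] [Algebra B C] : Algebra B (Fontainization p C) :=
  (Fontainization.lift p (algebraMap B C)).toAlgebra

open Fontainization

variable (B B' C : Type*) [CommRing B] [CommRing B'] [CommRing C] [IsFpAlgebra p B]
  [IsFpAlgebra p B'] [IsFpAlgebra p C] [PerfectRing B p] [PerfectRing B' p] [Algebra B B']
  [Algebra B C]

/-- The projection `ν₀ : C♭ → C` as a homomorphism of `B`-algebras. -/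
def projZero : Fontainization p C →ₐ[B] C where
  __ := proj p C 0
  commutes' _ := rfl

/-- The canonical homomorphism `W(C♭) ⊗_{W(B)} W(B') → W((C ⊗_B B')♭)`. -/
def wittTensorMap : WittTensor p B B' (Fontainization p C) →+*
    WittVector p (Fontainization p (C ⊗[B] B')) :=
  (Algebra.TensorProduct.lift (R := WittVector p B) (S := WittVector p B)
    ({ WittVector.map (Fontainization.map p
          (Algebra.TensorProduct.includeLeft : C →ₐ[B] C ⊗[B] B').toRingHom) with
        commutes' := fun x => by
          change WittVector.map _ (WittVector.map _ x) = WittVector.map _ x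
          ext n
          rfl } :
      WittVector p (Fontainization p C) →ₐ[WittVector p B]
        WittVector p (Fontainization p (C ⊗[B] B')))
    ({ WittVector.map (Fontainization.lift p
          (Algebra.TensorProduct.includeRight : B' →ₐ[B] C ⊗[B] B').toRingHom) with
        commutes' := fun x => by
          change WittVector.map _ (WittVector.map _ x) = WittVector.map _ x
          ext1 n
          have h := lift_comp p (Algebra.TensorProduct.includeRight :
            B' →ₐ[B] C ⊗[B] B').toRingHom (algebraMap B B')
          rw [AlgHom.toRingHom_eq_coe, AlgHom.comp_algebraMap] at h
          exact RingHom.congr_fun h (x.coeff n) } :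
      WittVector p B' →ₐ[WittVector p B] WittVector p (Fontainization p (C ⊗[B] B')))
    (fun _ _ => Commute.all _ _)).toRingHom

theorem wittTensorMap_tmul (x : WittVector p (Fontainization p C)) (y : WittVector p B') :
    wittTensorMap p B B' C (x ⊗ₜ y) =
      WittVector.map (Fontainization.map p
          (Algebra.TensorProduct.includeLeft : C →ₐ[B] C ⊗[B] B').toRingHom) x *
        WittVector.map (Fontainization.lift p
          (Algebra.TensorProduct.includeRight : B' →ₐ[B] C ⊗[B] B').toRingHom) y :=
  rfl

theorem wittToBase_wittTensorMap (z : WittTensor p B B' (Fontainization p C)) :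
    wittToBase p (C ⊗[B] B') (wittTensorMap p B B' C z) =
      Algebra.TensorProduct.map (projZero p B C) (AlgHom.id B B')
        (WittTensor.coeffZero p B B' (Fontainization p C) z) := by
  induction z using TensorProduct.induction_on with
  | zero => simp only [map_zero]
  | add z z' hz hz' => simp only [map_add, hz, hz']
  | tmul x y =>
    rw [wittTensorMap_tmul, map_mul, WittTensor.coeffZero_tmul, Algebra.TensorProduct.map_tmul]
    refine (Algebra.TensorProduct.tmul_mul_tmul _ _ _ _).trans ?_
    rw [one_mul, mul_one]
    rfl

/-- The density input. If ν_k(x) = c, then c ⊗ b comes from [x] ⊗ [b^{p^k}], because ν_k of the lift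
of b^{p^k} to the Fontainization undoes the power. -/
theorem wittTensorMap_proj_surjective [IsSemiperfect p C] (k : ℕ) :
    Function.Surjective fun z => proj p (C ⊗[B] B') k ((wittTensorMap p B B' C z).coeff 0) := by
  let q : WittTensor p B B' (Fontainization p C) →+* C ⊗[B] B' :=
    ((proj p (C ⊗[B] B') k).comp WittVector.constantCoeff).comp (wittTensorMap p B B' C)
  change Function.Surjective q
  rw [← RingHom.range_eq_top, eq_top_iff]
  rintro c -
  induction c using TensorProduct.induction_on with
  | zero => exact zero_mem _
  | add c c' hc hc' => exact add_mem hc hc'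
  | tmul c b =>
    obtain ⟨x, rfl⟩ := proj_surjective p k c
    refine ⟨WittVector.teichmuller p x ⊗ₜ WittVector.teichmuller p (b ^ p ^ k), ?_⟩
    change proj p (C ⊗[B] B') k (WittVector.constantCoeff (wittTensorMap p B B' C _)) = _
    have hb : proj p (C ⊗[B] B') k (Fontainization.lift p
        (Algebra.TensorProduct.includeRight : B' →ₐ[B] C ⊗[B] B').toRingHom (b ^ p ^ k)) =
          1 ⊗ₜ b := by
      rw [map_pow, map_pow, proj_pow]
      rfl
    rw [wittTensorMap_tmul, WittVector.map_teichmuller, WittVector.map_teichmuller, map_mul,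
      map_mul]
    change proj p (C ⊗[B] B') k (Fontainization.map p _ x) *
      proj p (C ⊗[B] B') k (Fontainization.lift p _ (b ^ p ^ k)) = _
    rw [hb]
    refine (Algebra.TensorProduct.tmul_mul_tmul _ _ _ _).trans ?_
    rw [one_mul, mul_one]
    rfl

theorem natCast_mem_ker_wittToBase :
    (p : WittVector p (Fontainization p C)) ∈ RingHom.ker (wittToBase p C) := by
  rw [RingHom.mem_ker, map_natCast, IsFpAlgebra.natCast_eq_zero]

variable [IsSemiperfect p C]

theorem exists_coeffZero_incl_eq (z : WittTensor p B B' (Fontainization p C))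
    (hz : wittToBase p (C ⊗[B] B') (wittTensorMap p B B' C z) = 0) :
    ∃ u, WittTensor.coeffZero p B B' _
        (WittTensor.incl p B B' _ (RingHom.ker (wittToBase p C)) u) =
      WittTensor.coeffZero p B B' _ z :=
  WittTensor.coeffZero_mem_range (RingHom.ker (proj p C 0)) (fun _ => Iff.rfl)
    (natCast_mem_ker_wittToBase p C) (projZero p B C) (proj_surjective p 0) (fun _ => Iff.rfl) z
    (by rwa [← wittToBase_wittTensorMap])

variable [Module.Flat B B']

/-- `W(C♭) ⊗_{W(B)} W(B')` and the base change of the kernel of `W(C♭) → C`. -/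
def kernelModelTensor : KernelModel p (C ⊗[B] B') (WittTensor p B B' (Fontainization p C))
    (WittTensor p B B' (Fontainization p C) ⊗[WittVector p (Fontainization p C)]
      RingHom.ker (wittToBase p C)) where
  g := wittTensorMap p B B' C
  ι := WittTensor.incl p B B' _ _
  pElt := 1 ⊗ₜ ⟨p, natCast_mem_ker_wittToBase p C⟩
  ι_pElt := by
    rw [WittTensor.incl_tmul, one_mul]
    exact map_natCast (algebraMap (WittVector p (Fontainization p C))
      (WittTensor p B B' (Fontainization p C))) p
  wittToBase_ι u := by
    induction u using TensorProduct.induction_on with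
    | zero => simp only [map_zero]
    | add u v hu hv => rw [map_add, map_add, map_add, hu, hv, add_zero]
    | tmul z x =>
      rw [WittTensor.incl_tmul, map_mul, map_mul, wittTensorMap_tmul, map_mul,
        Acris.wittToBase_map,
        show wittToBase p C x = 0 from x.2, map_zero, zero_mul, mul_zero]
  mem_range x hx := by
    obtain ⟨u, hu⟩ := exists_coeffZero_incl_eq p B B' C x hx
    obtain ⟨w, hw⟩ := WittTensor.exists_eq_mul_of_coeffZero
      (x - WittTensor.incl p B B' _ (RingHom.ker (wittToBase p C)) u) (by
        rw [map_sub, hu, sub_self])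
    refine ⟨u + w • (1 ⊗ₜ ⟨p, natCast_mem_ker_wittToBase p C⟩), ?_⟩
    have h : WittTensor.incl p B B' _ (RingHom.ker (wittToBase p C))
        (1 ⊗ₜ ⟨p, natCast_mem_ker_wittToBase p C⟩) = p := by
      rw [WittTensor.incl_tmul, one_mul]
      exact map_natCast (algebraMap (WittVector p (Fontainization p C))
        (WittTensor p B B' (Fontainization p C))) p
    rw [map_add, map_smul, h, smul_eq_mul, mul_comm, ← hw, add_sub_cancel]
  -- Write ι(u) = y^{p^k} + p w. Then y is in the kernel, since ν_0(y) = ν_k(y^{p^k}), so y agrees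
  -- with some ι(e) in P ⊗ B'. Hence u - ι(e)^{p^k-1} e vanishes there and is a multiple of [p].
  exists_eq k u hu := by
    obtain ⟨y, w, hyw⟩ := WittTensor.exists_eq_pow_add k
      (WittTensor.incl p B B' _ (RingHom.ker (wittToBase p C)) u)
    have hy : wittToBase p (C ⊗[B] B') (wittTensorMap p B B' C y) = 0 := by
      rw [← hu, hyw]
      change proj p _ 0 (WittVector.constantCoeff (wittTensorMap p B B' C y)) =
        proj p _ k (WittVector.constantCoeff (wittTensorMap p B B' C (y ^ p ^ k + p * w)))
      simp only [map_add, map_pow, map_mul, map_natCast, proj_pow, IsFpAlgebra.natCast_eq_zero,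
        zero_mul, add_zero]
    obtain ⟨e, he⟩ := exists_coeffZero_incl_eq p B B' C y hy
    obtain ⟨z, hz⟩ := WittTensor.exists_eq_smul_of_coeffZero_incl (RingHom.ker (proj p C 0))
      (fun _ => Iff.rfl) (natCast_mem_ker_wittToBase p C)
      (u - WittTensor.incl p B B' _ (RingHom.ker (wittToBase p C)) e ^ (p ^ k - 1) • e) (by
        rw [map_sub, map_smul, smul_eq_mul, ← pow_succ,
          Nat.sub_add_cancel (pow_pos (Fact.out : p.Prime).pos k), hyw, map_sub, map_add,
          map_pow, map_pow, he, map_mul, map_natCast, IsFpAlgebra.natCast_eq_zero, zero_mul,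
          add_zero, sub_self])
    exact ⟨e, z, sub_eq_iff_eq_add'.1 hz⟩

end BaseChangeModel

/-! ### Extension from X and M to `W(C♭)` and its kernel -/

namespace KernelModel

variable {p : ℕ} [Fact p.Prime] {C : Type*} [CommRing C] [IsFpAlgebra p C] {X M : Type*}
  [CommRing X] [AddCommGroup M] [Module X M] (K : KernelModel p C X M)
  (hg : ∀ k, Function.Surjective fun x => Fontainization.proj p C k ((K.g x).coeff 0))
  {Q : Type*} [CommRing Q] [Algebra X Q] (E : M →ₗ[X] ExpSeries Q)
  (h1 : ∀ u, (E u).coeff 1 = algebraMap X Q (K.ι u)) {n : ℕ} (hn : (p : Q) ^ n = 0)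
  (hp : ∀ m, 0 < m → (p : Q) ∣ (E K.pElt).coeff m)

include h1 hn in
theorem algebraMap_eq_of_mem_nearZero {x x' : X} {y : WittVector p (Fontainization p C)}
    (hx : y - K.g x ∈ nearZero p C (n + 1) (n * p + (n + 1)))
    (hx' : y - K.g x' ∈ nearZero p C (n + 1) (n * p + (n + 1))) :
    algebraMap X Q x = algebraMap X Q x' := by
  have h : K.g (x - x') ∈ nearZero p C (n + 1) (n * p + (n + 1)) := by
    have h := Ideal.sub_mem _ hx' hx
    rwa [sub_sub_sub_cancel_left, ← map_sub] at h
  obtain ⟨c, hc⟩ := K.pow_dvd_of_mem_nearZero E h1 hn _ h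
  rw [← sub_eq_zero, ← map_sub, hc, pow_succ, hn, zero_mul, zero_mul]

/-- The extension of `X → Q` to `W(C♭)` by approximation. -/
def extend : WittVector p (Fontainization p C) →+* Q :=
  let a := fun y => (K.exists_sub_mem_nearZero hg (n + 1) (n * p) y).choose
  have ha : ∀ y, y - K.g (a y) ∈ nearZero p C (n + 1) (n * p + (n + 1)) :=
    fun y => (K.exists_sub_mem_nearZero hg (n + 1) (n * p) y).choose_spec
  { toFun := fun y => algebraMap X Q (a y)
    map_one' := by
      rw [← map_one (algebraMap X Q)]
      refine K.algebraMap_eq_of_mem_nearZero E h1 hn (ha 1) ?_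
      rw [map_one, sub_self]
      exact zero_mem _
    map_zero' := by
      rw [← map_zero (algebraMap X Q)]
      refine K.algebraMap_eq_of_mem_nearZero E h1 hn (ha 0) ?_
      rw [map_zero, sub_self]
      exact zero_mem _
    map_add' := fun y z => by
      rw [← map_add (algebraMap X Q)]
      refine K.algebraMap_eq_of_mem_nearZero E h1 hn (ha _) ?_
      rw [map_add, add_sub_add_comm]
      exact add_mem (ha y) (ha z)
    map_mul' := fun y z => by
      rw [← map_mul (algebraMap X Q)]
      refine K.algebraMap_eq_of_mem_nearZero E h1 hn (ha _) ?_
      have h : y * z - K.g (a y * a z) = z * (y - K.g (a y)) + K.g (a y) * (z - K.g (a z)) := by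
        rw [map_mul]
        ring
      rw [h]
      exact add_mem (Ideal.mul_mem_left _ _ (ha y)) (Ideal.mul_mem_left _ _ (ha z)) }

theorem extend_eq {x : X} {y : WittVector p (Fontainization p C)}
    (hx : y - K.g x ∈ nearZero p C (n + 1) (n * p + (n + 1))) :
    K.extend hg E h1 hn y = algebraMap X Q x :=
  K.algebraMap_eq_of_mem_nearZero E h1 hn
    (K.exists_sub_mem_nearZero hg (n + 1) (n * p) y).choose_spec hx

include h1 hn hp in
theorem exp_eq_of_mem_nearZero {u u' : M} {y : WittVector p (Fontainization p C)}
    (hu : y - K.g (K.ι u) ∈ nearZero p C (n + 1) (n * p + (n + 1)))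
    (hu' : y - K.g (K.ι u') ∈ nearZero p C (n + 1) (n * p + (n + 1))) : E u = E u' := by
  have h : K.g (K.ι (u - u')) ∈ nearZero p C (n + 1) (n * p + (n + 1)) := by
    have h := Ideal.sub_mem _ hu' hu
    rwa [sub_sub_sub_cancel_left, ← map_sub, ← map_sub] at h
  rw [← add_sub_cancel u' u, map_add, K.exp_eq_zero_of_mem_nearZero E h1 hn hp _ h, add_zero]

/-- The extension of `E : M → ExpSeries Q` to the kernel of `W(C♭) → C` by approximation. -/
def extendExp :
    letI := (K.extend hg E h1 hn).toAlgebra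
    RingHom.ker (wittToBase p C) →ₗ[WittVector p (Fontainization p C)] ExpSeries Q :=
  letI := (K.extend hg E h1 hn).toAlgebra
  let a := fun y : RingHom.ker (wittToBase p C) =>
    (K.exists_sub_ι_mem_nearZero hg n (n * p) y y.2).choose
  have ha : ∀ y : RingHom.ker (wittToBase p C),
      (y : WittVector p (Fontainization p C)) - K.g (K.ι (a y)) ∈
        nearZero p C (n + 1) (n * p + (n + 1)) :=
    fun y => (K.exists_sub_ι_mem_nearZero hg n (n * p) y y.2).choose_spec
  { toFun := fun y => E (a y)
    map_add' := fun y z => by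
      rw [← map_add E]
      refine K.exp_eq_of_mem_nearZero E h1 hn hp (ha _) ?_
      rw [map_add, map_add, Submodule.coe_add, add_sub_add_comm]
      exact add_mem (ha y) (ha z)
    map_smul' := fun y z => by
      obtain ⟨x, hx⟩ := K.exists_sub_mem_nearZero hg (n + 1) (n * p) y
      have h : E (x • a z) = y • E (a z) := by
        rw [map_smul]
        ext m
        rw [ExpSeries.coeff_smul, ExpSeries.coeff_smul, ← K.extend_eq hg E h1 hn hx]
        rfl
      rw [RingHom.id_apply, ← h]
      refine K.exp_eq_of_mem_nearZero E h1 hn hp (ha _) ?_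
      -- If x approximates the scalar y, then x • a z approximates y • z.
      have h : ((y • z : RingHom.ker (wittToBase p C)) : WittVector p (Fontainization p C)) -
          K.g (K.ι (x • a z)) = z * (y - K.g x) + K.g x * (z - K.g (K.ι (a z))) := by
        rw [map_smul, smul_eq_mul, map_mul, Submodule.coe_smul, smul_eq_mul]
        ring
      rw [h]
      exact add_mem (Ideal.mul_mem_left _ _ hx) (Ideal.mul_mem_left _ _ (ha z)) }

theorem extendExp_eq {u : M} {y : RingHom.ker (wittToBase p C)}
    (hu : (y : WittVector p (Fontainization p C)) - K.g (K.ι u) ∈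
      nearZero p C (n + 1) (n * p + (n + 1))) :
    K.extendExp hg E h1 hn hp y = E u :=
  K.exp_eq_of_mem_nearZero E h1 hn hp
    (K.exists_sub_ι_mem_nearZero hg n (n * p) y y.2).choose_spec hu

variable (hden : ∀ m : ℕ,
    ((((p : ℚ) ^ m / (m.factorial : ℚ)).den : ℕ) : Q) * (E K.pElt).coeff m =
      ((((p : ℚ) ^ m / (m.factorial : ℚ)).num : ℤ) : Q))

/-- The homomorphism from the PD hull of `W(C♭) → C` to `Q` defined by `X → Q` and `E`. -/
def liftPDHull : PDHull p (RingHom.ker (wittToBase p C)) →+* Q :=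
  letI := (K.extend hg E h1 hn).toAlgebra
  PDHull.lift p _ (K.extendExp hg E h1 hn hp)
    (fun y => by
      obtain ⟨u, hu⟩ := K.exists_sub_ι_mem_nearZero hg n (n * p) y y.2
      rw [K.extendExp_eq hg E h1 hn hp hu, h1]
      exact (K.extend_eq hg E h1 hn hu).symm)
    (fun h m => by
      rw [K.extendExp_eq hg E h1 hn hp (u := K.pElt), hden]
      rw [K.ι_pElt, map_natCast, sub_self]
      exact zero_mem _)

theorem liftPDHull_of {x : X} {y : WittVector p (Fontainization p C)}
    (hx : y - K.g x ∈ nearZero p C (n + 1) (n * p + (n + 1))) :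
    K.liftPDHull hg E h1 hn hp hden (PDHull.of p _ y) = algebraMap X Q x := by
  let _ := (K.extend hg E h1 hn).toAlgebra
  exact (PDHull.lift_of p _ _ _ _ y).trans (K.extend_eq hg E h1 hn hx)

theorem liftPDHull_gamma {u : M} {y : RingHom.ker (wittToBase p C)} (m : ℕ)
    (hu : (y : WittVector p (Fontainization p C)) - K.g (K.ι u) ∈
      nearZero p C (n + 1) (n * p + (n + 1))) :
    K.liftPDHull hg E h1 hn hp hden (PDHull.gamma p _ m y) = (E u).coeff m := by
  let _ := (K.extend hg E h1 hn).toAlgebra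
  exact (PDHull.lift_gamma p _ _ _ _ m y).trans
    (congrArg (fun a => a.coeff m) (K.extendExp_eq hg E h1 hn hp hu))

end KernelModel

/-! ### Divisibility of γ_m(p) by p -/

theorem ExpSeries.coeff_one_add {R : Type*} [CommRing R] (a b : ExpSeries R) :
    (a + b).coeff 1 = a.coeff 1 + b.coeff 1 := by
  have h : Finset.HasAntidiagonal.antidiagonal 1 = {(0, 1), (1, 0)} := rfl
  rw [ExpSeries.coeff_add, h, Finset.sum_pair (by simp), a.coeff_zero, b.coeff_zero, one_mul,
    mul_one, add_comm]

/-- The p-adic valuation of m! is less than m for m > 0. -/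
theorem dvd_num_pow_div_factorial (p : ℕ) [Fact p.Prime] {m : ℕ} (hm : 0 < m) :
    (p : ℤ) ∣ ((p : ℚ) ^ m / (m.factorial : ℚ)).num := by
  set q : ℚ := (p : ℚ) ^ m / (m.factorial : ℚ) with hq
  have h : q.num * (m.factorial : ℤ) = (p : ℤ) ^ m * (q.den : ℤ) := by
    have h1 : (q.num : ℚ) / q.den = (p : ℚ) ^ m / (m.factorial : ℚ) := by
      rw [Rat.num_div_den]
    rw [div_eq_div_iff (by exact_mod_cast q.den_ne_zero)
      (by exact_mod_cast m.factorial_ne_zero)] at h1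
    exact_mod_cast h1
  by_contra hnd
  have hc : IsCoprime ((p : ℤ) ^ m) q.num :=
    ((Nat.prime_iff_prime_int.1 Fact.out).coprime_iff_not_dvd.2 hnd).pow_left
  have hd : (p : ℤ) ^ m ∣ (m.factorial : ℤ) :=
    hc.dvd_of_dvd_mul_left ⟨_, h⟩
  have hd' : p ^ m ∣ m.factorial := by exact_mod_cast hd
  rw [padicValNat_dvd_iff_le m.factorial_ne_zero] at hd'
  exact absurd (padicValNat_factorial_lt_of_ne_zero p hm.ne') hd'.not_gt

/-- The denominator is coprime to the numerator, hence to p, so it is invertible in Q, where p is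
nilpotent. -/
theorem dvd_of_den_mul_eq_num (p : ℕ) [Fact p.Prime] {Q : Type*} [CommRing Q] {n : ℕ}
    (hn : (p : Q) ^ n = 0) {m : ℕ} (hm : 0 < m) (c : Q)
    (hc : ((((p : ℚ) ^ m / (m.factorial : ℚ)).den : ℕ) : Q) * c =
      ((((p : ℚ) ^ m / (m.factorial : ℚ)).num : ℤ) : Q)) : (p : Q) ∣ c := by
  have hnum := dvd_num_pow_div_factorial p hm
  set q : ℚ := (p : ℚ) ^ m / (m.factorial : ℚ) with hq
  have hcop : IsCoprime ((p : ℤ) ^ n) (q.den : ℤ) := by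
    refine IsCoprime.pow_left ?_
    have h : IsCoprime q.num (q.den : ℤ) := Rat.isCoprime_num_den q
    exact h.of_isCoprime_of_dvd_left hnum
  obtain ⟨a, b, hab⟩ := hcop
  obtain ⟨d, hd⟩ := hnum
  have hab' : (a : Q) * p ^ n + b * (q.den : Q) = 1 := by
    exact_mod_cast congrArg (Int.cast : ℤ → Q) hab
  refine ⟨b * d, ?_⟩
  rw [hd] at hc
  push_cast at hc
  rw [hn] at hab'
  linear_combination (-c) * hab' + (b : Q) * hc

/-! ### Continuity of homomorphisms from the PD hull -/

namespace PDHull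

variable {p : ℕ} [Fact p.Prime] {C : Type*} [CommRing C] [IsFpAlgebra p C]

theorem dvd_map_gamma {A R : Type*} [CommRing A] [CommRing R] {I : Ideal A} {n : ℕ}
    (hn : (p : R) ^ n = 0) (ψ : PDHull p I →+* R) (h : (p : A) ∈ I) {m : ℕ} (hm : 0 < m) :
    (p : R) ∣ ψ (gamma p I m ⟨p, h⟩) :=
  dvd_of_den_mul_eq_num p hn hm _ (by
    have h := congrArg ψ (den_mul_gamma p I h m)
    rwa [map_mul, map_natCast, map_intCast] at h)

variable {R : Type*} [CommRing R] {n : ℕ} (hn : (p : R) ^ n = 0)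
  (ψ : PDHull p (RingHom.ker (wittToBase p C)) →+* R)

include hn

/-- `kernelModelSelf` makes the vanishing results apply to W(C♭) itself, with y approximating
itself. -/
theorem map_of_eq_of_nearZero {y y' : WittVector p (Fontainization p C)}
    (h : y - y' ∈ nearZero p C (n + 1) (n * p + (n + 1))) :
    ψ (of p _ y) = ψ (of p _ y') := by
  let _ : Algebra (WittVector p (Fontainization p C)) R := (ψ.comp (of p _)).toAlgebra
  refine (kernelModelSelf p C).algebraMap_eq_of_mem_nearZero
    (expMap p (RingHom.ker (wittToBase p C)) ψ fun _ => rfl)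
    (fun u => congrArg ψ (gamma_one p _ u)) hn (y := y) ?_ h
  change y - y ∈ _
  rw [sub_self]
  exact zero_mem _

theorem map_gamma_eq_of_nearZero {y y' : RingHom.ker (wittToBase p C)}
    (h : (y : WittVector p (Fontainization p C)) - y' ∈
      nearZero p C (n + 1) (n * p + (n + 1))) (m : ℕ) :
    ψ (gamma p _ m y) = ψ (gamma p _ m y') := by
  let _ : Algebra (WittVector p (Fontainization p C)) R := (ψ.comp (of p _)).toAlgebra
  refine congrArg (fun a => a.coeff m) ((kernelModelSelf p C).exp_eq_of_mem_nearZero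
    (expMap p (RingHom.ker (wittToBase p C)) ψ fun _ => rfl)
    (fun u => congrArg ψ (gamma_one p _ u)) hn (fun m hm => dvd_map_gamma hn ψ _ hm)
    (y := (y : WittVector p (Fontainization p C))) ?_ h)
  change (y : WittVector p (Fontainization p C)) - y ∈ _
  rw [sub_self]
  exact zero_mem _

end PDHull

/-! ### The universal property of the PD hull of `C ⊗_B B'` modulo p^n -/

section BaseChange

variable (p : ℕ) [Fact p.Prime] (B B' C : Type*) [CommRing B] [CommRing B'] [CommRing C]
  [IsFpAlgebra p B] [IsFpAlgebra p B'] [IsFpAlgebra p C] [PerfectRing B p] [PerfectRing B' p]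
  [Algebra B B'] [Algebra B C]

/-- The homomorphism of PD hulls induced by `C → C ⊗_B B'`. -/
def pdHullMap : PDHull p (RingHom.ker (wittToBase p C)) →+*
    PDHull p (RingHom.ker (wittToBase p (C ⊗[B] B'))) :=
  PDHull.map p (WittVector.map (Fontainization.map p
      (Algebra.TensorProduct.includeLeft : C →ₐ[B] C ⊗[B] B').toRingHom)) (fun x hx => by
    rw [RingHom.mem_ker] at hx ⊢
    rw [Acris.wittToBase_map, hx, map_zero])

/-- The homomorphism from `W(B')` to the PD hull induced by `B' → C ⊗_B B'`. -/
def pdHullBase : WittVector p B' →+* PDHull p (RingHom.ker (wittToBase p (C ⊗[B] B'))) :=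
  (PDHull.of p _).comp (WittVector.map (Fontainization.lift p
    (Algebra.TensorProduct.includeRight : B' →ₐ[B] C ⊗[B] B').toRingHom))

variable {p B B' C} [IsSemiperfect p C] [Module.Flat B B']

/-- By continuity and density only elements coming from X and M matter, and on these both
homomorphisms are determined by pure tensors. -/
theorem pdHull_ringHom_ext {R : Type*} [CommRing R] {n : ℕ} (hn : (p : R) ^ n = 0)
    {θ θ' : PDHull p (RingHom.ker (wittToBase p (C ⊗[B] B'))) →+* R}
    (hleft : ∀ d, θ (pdHullMap p B B' C d) = θ' (pdHullMap p B B' C d))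
    (hright : ∀ y, θ (pdHullBase p B B' C y) = θ' (pdHullBase p B B' C y)) : θ = θ' := by
  let K := kernelModelTensor p B B' C
  have hg := wittTensorMap_proj_surjective p B B' C
  have h0 : ∀ z, θ (PDHull.of p _ (K.g z)) = θ' (PDHull.of p _ (K.g z)) := fun z => by
    induction z using TensorProduct.induction_on with
    | zero => simp only [map_zero]
    | add z z' hz hz' => simp only [map_add, hz, hz']
    | tmul x y =>
      have hx := hleft (PDHull.of p _ x)
      rw [pdHullMap, PDHull.map_of] at hx
      change θ (PDHull.of p _ (wittTensorMap p B B' C _)) =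
        θ' (PDHull.of p _ (wittTensorMap p B B' C _))
      rw [wittTensorMap_tmul, map_mul, map_mul, map_mul, hx]
      exact congrArg _ (hright y)
  have h1 : ∀ u (y : RingHom.ker (wittToBase p (C ⊗[B] B'))),
      (y : WittVector p (Fontainization p (C ⊗[B] B'))) = K.g (K.ι u) →
      ∀ m, θ (PDHull.gamma p _ m y) = θ' (PDHull.gamma p _ m y) := by
    intro u
    induction u using TensorProduct.induction_on with
    | zero =>
      intro y hy m
      -- As y = 0 • y, its m-th divided power has the factor 0^m, which leaves m = 0 as a separate
      -- case.
      have h : y = (0 : WittVector p (Fontainization p (C ⊗[B] B'))) • y := by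
        rw [zero_smul]
        exact Subtype.ext (hy.trans (by rw [map_zero, map_zero]; rfl))
      rcases Nat.eq_zero_or_pos m with rfl | hm
      · have h0 : PDHull.gamma p _ 0 y = 1 := (PDHull.expGamma p _ y).coeff_zero
        rw [h0, map_one, map_one]
      · rw [h, PDHull.gamma_smul, map_zero, zero_pow hm.ne', zero_mul, map_zero, map_zero]
    | add u v hu hv =>
      intro y hy m
      let yu : RingHom.ker (wittToBase p (C ⊗[B] B')) := ⟨_, K.wittToBase_ι u⟩
      let yv : RingHom.ker (wittToBase p (C ⊗[B] B')) := ⟨_, K.wittToBase_ι v⟩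
      have h : y = yu + yv := Subtype.ext (hy.trans (by rw [map_add, map_add]; rfl))
      have hadd : PDHull.gamma p _ m (yu + yv) = ∑ ij ∈ Finset.HasAntidiagonal.antidiagonal m,
          PDHull.gamma p _ ij.1 yu * PDHull.gamma p _ ij.2 yv :=
        congrArg (fun a => a.coeff m) (PDHull.expGamma_add p _ yu yv)
      rw [h, hadd, map_sum, map_sum]
      refine Finset.sum_congr rfl fun ij _ => ?_
      rw [map_mul, map_mul, hu yu rfl, hv yv rfl]
    | tmul z x =>
      intro y hy m
      have h : y = K.g z • (⟨WittVector.map (Fontainization.map p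
            (Algebra.TensorProduct.includeLeft : C →ₐ[B] C ⊗[B] B').toRingHom) x, by
              rw [RingHom.mem_ker, Acris.wittToBase_map, show wittToBase p C x = 0 from x.2,
                map_zero]⟩ : RingHom.ker (wittToBase p (C ⊗[B] B'))) := by
        refine Subtype.ext (hy.trans ?_)
        change wittTensorMap p B B' C (WittTensor.incl p B B' _ _ _) =
          wittTensorMap p B B' C z * _
        rw [WittTensor.incl_tmul, map_mul, wittTensorMap_tmul, map_one, mul_one]
      have hx := hleft (PDHull.gamma p _ m x)
      rw [pdHullMap, PDHull.map_gamma] at hx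
      rw [h, PDHull.gamma_smul, map_mul, map_mul, map_pow, map_pow, h0, hx]
  refine PDHull.ringHom_ext p _ (fun y => ?_) (fun m y => ?_)
  · obtain ⟨x, hx⟩ := K.exists_sub_mem_nearZero hg (n + 1) (n * p) y
    rw [PDHull.map_of_eq_of_nearZero hn θ hx, PDHull.map_of_eq_of_nearZero hn θ' hx, h0]
  · obtain ⟨u, hu⟩ := K.exists_sub_ι_mem_nearZero hg n (n * p) y y.2
    let yu : RingHom.ker (wittToBase p (C ⊗[B] B')) := ⟨_, K.wittToBase_ι u⟩
    rw [PDHull.map_gamma_eq_of_nearZero hn θ (y' := yu) hu,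
      PDHull.map_gamma_eq_of_nearZero hn θ' (y' := yu) hu, h1 u yu rfl]

variable {Q : Type*} [CommRing Q] {n : ℕ} (hn : (p : Q) ^ n = 0)
  (ρ : PDHull p (RingHom.ker (wittToBase p C)) →+* Q) (σ : WittVector p B' →+* Q)
  (hρσ : ∀ x : WittVector p B, ρ (PDHull.of p _ (algebraMap _ _ x)) = σ (algebraMap _ _ x))

-- ρ and σ give X → Q, and the divided powers transported by ρ extend by scalars to E on M;
-- `KernelModel.liftPDHull` then extends both by approximation.
include hn hρσ in
theorem exists_pdHull_lift :
    ∃ Ψ : PDHull p (RingHom.ker (wittToBase p (C ⊗[B] B'))) →+* Q,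
      (∀ d, Ψ (pdHullMap p B B' C d) = ρ d) ∧ ∀ y, Ψ (pdHullBase p B B' C y) = σ y := by
  let K := kernelModelTensor p B B' C
  have hg : ∀ k, Function.Surjective fun x =>
      Fontainization.proj p (C ⊗[B] B') k ((K.g x).coeff 0) :=
    wittTensorMap_proj_surjective p B B' C
  let _ : Algebra (WittVector p (Fontainization p C)) Q := (ρ.comp (PDHull.of p _)).toAlgebra
  let _ : Algebra (WittVector p B) Q := (σ.comp (algebraMap _ _)).toAlgebra
  let π : WittTensor p B B' (Fontainization p C) →+* Q :=
    (Algebra.TensorProduct.lift (R := WittVector p B) (S := WittVector p B)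
      ({ ρ.comp (PDHull.of p _) with commutes' := hρσ } :
        WittVector p (Fontainization p C) →ₐ[WittVector p B] Q)
      ({ σ with commutes' := fun _ => rfl } : WittVector p B' →ₐ[WittVector p B] Q)
      (fun _ _ => Commute.all _ _)).toRingHom
  have hπ : ∀ x y, π (x ⊗ₜ y) = ρ (PDHull.of p _ x) * σ y := fun _ _ => rfl
  let _ : Algebra (WittTensor p B B' (Fontainization p C)) Q := π.toAlgebra
  have _ : IsScalarTower (WittVector p (Fontainization p C))
      (WittTensor p B B' (Fontainization p C)) Q :=
    IsScalarTower.of_algebraMap_eq fun x => ((hπ x 1).trans (by rw [map_one, mul_one]; rfl)).symm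
  let E := LinearMap.liftBaseChange (WittTensor p B B' (Fontainization p C))
    (PDHull.expMap p (RingHom.ker (wittToBase p C)) ρ fun _ => rfl)
  have hE : ∀ z x m, (E (z ⊗ₜ x)).coeff m = π z ^ m * ρ (PDHull.gamma p _ m x) := fun _ _ _ => rfl
  have hE1 : ∀ x m, (E (1 ⊗ₜ x)).coeff m = ρ (PDHull.gamma p _ m x) := fun x m => by
    rw [hE, map_one, one_pow, one_mul]
  have h1 : ∀ u, (E u).coeff 1 = algebraMap _ Q (K.ι u) := fun u => by
    induction u using TensorProduct.induction_on with
    | zero => rw [map_zero, map_zero, map_zero]; rfl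
    | add u v hu hv =>
      rw [map_add, map_add, map_add, ← hu, ← hv, ExpSeries.coeff_one_add]
    | tmul z x =>
      rw [hE, pow_one, PDHull.gamma_one]
      change _ = π (WittTensor.incl p B B' _ _ _)
      rw [WittTensor.incl_tmul, map_mul, hπ, map_one, mul_one]
  have hp : ∀ m, 0 < m → (p : Q) ∣ (E K.pElt).coeff m := fun m hm => by
    refine (hE1 _ m).symm ▸ PDHull.dvd_map_gamma hn ρ _ hm
  have hden : ∀ m : ℕ, ((((p : ℚ) ^ m / (m.factorial : ℚ)).den : ℕ) : Q) * (E K.pElt).coeff m =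
      ((((p : ℚ) ^ m / (m.factorial : ℚ)).num : ℤ) : Q) := fun m => by
    refine (congrArg _ (hE1 _ m)).trans ?_
    have h := congrArg ρ (PDHull.den_mul_gamma p _ (natCast_mem_ker_wittToBase p C) m)
    rwa [map_mul, map_natCast, map_intCast] at h
  have hleft : ∀ x, WittVector.map (Fontainization.map p
      (Algebra.TensorProduct.includeLeft : C →ₐ[B] C ⊗[B] B').toRingHom) x - K.g (x ⊗ₜ 1) ∈
        nearZero p (C ⊗[B] B') (n + 1) (n * p + (n + 1)) := fun x => by
    change _ - wittTensorMap p B B' C _ ∈ _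
    rw [wittTensorMap_tmul, map_one, mul_one, sub_self]
    exact zero_mem _
  refine ⟨K.liftPDHull hg E h1 hn hp hden, fun d => ?_, fun y => ?_⟩
  · suffices h : (K.liftPDHull hg E h1 hn hp hden).comp (pdHullMap p B B' C) = ρ from
      RingHom.congr_fun h d
    refine PDHull.ringHom_ext p _ (fun x => ?_) (fun m x => ?_)
    · rw [RingHom.comp_apply, pdHullMap, PDHull.map_of]
      exact (K.liftPDHull_of _ _ _ _ _ _ (hleft x)).trans
        ((hπ x 1).trans (by rw [map_one, mul_one]))
    · rw [RingHom.comp_apply, pdHullMap, PDHull.map_gamma]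
      refine (K.liftPDHull_gamma (u := 1 ⊗ₜ x) _ _ _ _ _ _ m ?_).trans (hE1 x m)
      · have h : K.ι (1 ⊗ₜ x) = (x : WittVector p (Fontainization p C)) ⊗ₜ 1 :=
          (WittTensor.incl_tmul p B B' _ _ 1 x).trans (one_mul _)
        rw [h]
        exact hleft x
  · refine (K.liftPDHull_of (x := 1 ⊗ₜ y) _ _ _ _ _ _ ?_).trans ?_
    · change _ - wittTensorMap p B B' C _ ∈ _
      rw [wittTensorMap_tmul, map_one, one_mul, sub_self]
      exact zero_mem _
    · exact (hπ 1 y).trans (by rw [map_one, map_one, one_mul])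

end BaseChange

/-! ### The isomorphism modulo p^n -/

section Main

theorem PCompletion.liftAux_mk {p : ℕ} {R S : Type*} [CommRing R] [CommRing S]
    (g : R →+* PCompletion p S) (n : ℕ) (r : R) :
    liftAux p g n (Ideal.Quotient.mk _ r) = AdicCompletion.evalₐ _ n (g r) := rfl

/-- The canonical homomorphism from the PD hull to `A_cris(C)`. -/
def Acris.of (p : ℕ) [Fact p.Prime] (C : Type*) [CommRing C] [IsFpAlgebra p C] :
    PDHull p (RingHom.ker (wittToBase p C)) →+* Acris p C :=
  PCompletion.of p _

theorem Acris.exists_eq_of_add {p : ℕ} [Fact p.Prime] {C : Type*} [CommRing C] [IsFpAlgebra p C]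
    (n : ℕ) (a : Acris p C) : ∃ d a', a = Acris.of p C d + (p : Acris p C) ^ n * a' :=
  PCompletion.exists_eq_of_add p n a


variable {p : ℕ} [Fact p.Prime] {B B' C : Type*} [CommRing B] [CommRing B'] [CommRing C]
  [IsFpAlgebra p B] [IsFpAlgebra p B'] [IsFpAlgebra p C] [PerfectRing B p] [PerfectRing B' p]
  [Algebra B B'] [Algebra B C]

theorem natCast_pow_quotient_eq_zero (p n : ℕ) (R : Type*) [CommRing R] :
    (p : R ⧸ Ideal.span {(p : R)} ^ n) ^ n = 0 := by
  rw [← map_natCast (Ideal.Quotient.mk (Ideal.span {(p : R)} ^ n)), ← map_pow]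
  exact Ideal.Quotient.eq_zero_iff_mem.2 (Ideal.pow_mem_pow (Ideal.mem_span_singleton_self _) n)

/-- If Φ kills Ψ(d), then d is divisible by p^n, and Ψ(d) = 0 because p^n = 0 in the target of Ψ. -/
theorem bijective_of_rightInverse_mod (p n : ℕ) {T D : Type*} [CommRing T] [CommRing D]
    (Φ : T ⧸ Ideal.span {(p : T)} ^ n →+* D ⧸ Ideal.span {(p : D)} ^ n)
    (Ψ : D →+* T ⧸ Ideal.span {(p : T)} ^ n) (hΦΨ : ∀ d, Φ (Ψ d) = Ideal.Quotient.mk _ d)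
    (hΨ : ∀ t, ∃ d, Ψ d = Ideal.Quotient.mk _ t) : Function.Bijective Φ := by
  constructor
  · rw [injective_iff_map_eq_zero]
    intro q hq
    obtain ⟨t, rfl⟩ := Ideal.Quotient.mk_surjective q
    obtain ⟨d, hd⟩ := hΨ t
    rw [← hd, hΦΨ, Ideal.Quotient.eq_zero_iff_mem, Ideal.span_singleton_pow,
      Ideal.mem_span_singleton'] at hq
    obtain ⟨c, rfl⟩ := hq
    rw [← hd, map_mul, map_pow, map_natCast, natCast_pow_quotient_eq_zero, mul_zero]
  · intro q
    obtain ⟨d, rfl⟩ := Ideal.Quotient.mk_surjective q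
    exact ⟨Ψ d, hΦΨ d⟩

/-- The homomorphism modulo `p ^ n` induced by `Acris.tensorMap`. -/
def tensorMapMod (p : ℕ) [Fact p.Prime] (B B' C : Type*) [CommRing B] [CommRing B'] [CommRing C]
    [IsFpAlgebra p B] [IsFpAlgebra p B'] [IsFpAlgebra p C] [PerfectRing B p] [PerfectRing B' p]
    [Algebra B B'] [Algebra B C] (n : ℕ) :=
  PCompletion.liftAux (R := Acris p C ⊗[WittVector p B] WittVector p B')
    (S := PDHull p (RingHom.ker (wittToBase p (C ⊗[B] B')))) p (Acris.tensorMap p B B' C) n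

theorem tensorMap_of_tmul_one (d : PDHull p (RingHom.ker (wittToBase p C))) :
    Acris.tensorMap p B B' C (Acris.of p C d ⊗ₜ 1) = Acris.of p _ (pdHullMap p B B' C d) := by
  rw [Acris.tensorMap_tmul, map_one, mul_one]
  exact PCompletion.map_of p (pdHullMap p B B' C) d

theorem tensorMap_one_tmul (y : WittVector p B') :
    Acris.tensorMap p B B' C (1 ⊗ₜ y) = Acris.of p _ (pdHullBase p B B' C y) := by
  rw [Acris.tensorMap_tmul, map_one, one_mul]
  rfl

theorem tensorMapMod_of_tmul_one (n : ℕ) (d : PDHull p (RingHom.ker (wittToBase p C))) :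
    tensorMapMod p B B' C n (Ideal.Quotient.mk _ (Acris.of p C d ⊗ₜ 1)) =
      Ideal.Quotient.mk _ (pdHullMap p B B' C d) :=
  (PCompletion.liftAux_mk (S := PDHull p (RingHom.ker (wittToBase p (C ⊗[B] B'))))
    (Acris.tensorMap p B B' C) n _).trans
    (congrArg (AdicCompletion.evalₐ (Ideal.span {(p : PDHull p _)}) n) (tensorMap_of_tmul_one d))

theorem tensorMapMod_one_tmul (n : ℕ) (y : WittVector p B') :
    tensorMapMod p B B' C n (Ideal.Quotient.mk _ (1 ⊗ₜ y)) =
      Ideal.Quotient.mk _ (pdHullBase p B B' C y) :=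
  (PCompletion.liftAux_mk (S := PDHull p (RingHom.ker (wittToBase p (C ⊗[B] B'))))
    (Acris.tensorMap p B B' C) n _).trans
    (congrArg (AdicCompletion.evalₐ (Ideal.span {(p : PDHull p _)}) n) (tensorMap_one_tmul y))

theorem tensorMapMod_bijective [IsSemiperfect p C] [Module.Flat B B'] (n : ℕ) :
    Function.Bijective (tensorMapMod p B B' C n) := by
  let T := Acris p C ⊗[WittVector p B] WittVector p B'
  let mkT : T →+* T ⧸ Ideal.span {(p : T)} ^ n := Ideal.Quotient.mk _
  let ρ : PDHull p (RingHom.ker (wittToBase p C)) →+* T ⧸ Ideal.span {(p : T)} ^ n :=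
    (mkT.comp (Algebra.TensorProduct.includeLeftRingHom :
      Acris p C →+* T)).comp (Acris.of p C)
  let σ : WittVector p B' →+* T ⧸ Ideal.span {(p : T)} ^ n :=
    mkT.comp (Algebra.TensorProduct.includeRight :
      WittVector p B' →ₐ[WittVector p B] T).toRingHom
  have hn : (p : T ⧸ Ideal.span {(p : T)} ^ n) ^ n = 0 := natCast_pow_quotient_eq_zero p n T
  obtain ⟨Ψ, hΨl, hΨr⟩ := exists_pdHull_lift hn ρ σ (fun x => congrArg mkT
    (Algebra.TensorProduct.tmul_one_eq_one_tmul (A := Acris p C) (B := WittVector p B') x))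
  have hΦΨ : ∀ d, tensorMapMod p B B' C n (Ψ d) = Ideal.Quotient.mk _ d := fun d =>
    RingHom.congr_fun (f := (tensorMapMod p B B' C n).comp Ψ)
      (pdHull_ringHom_ext (natCast_pow_quotient_eq_zero p n _)
        (fun d => (congrArg _ (hΨl d)).trans (tensorMapMod_of_tmul_one n d))
        (fun y => (congrArg _ (hΨr y)).trans (tensorMapMod_one_tmul n y))) d
  have hΨ : ∀ t, ∃ d, Ψ d = mkT t := fun t => by
    change mkT t ∈ Ψ.range
    induction t using TensorProduct.induction_on with
    | zero => rw [map_zero]; exact zero_mem _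
    | add t t' ht ht' => rw [map_add]; exact add_mem ht ht'
    | tmul a y =>
      -- Modulo p^n every element of A_cris(C) comes from the uncompleted PD hull, where Ψ is
      -- controlled.
      obtain ⟨d, a', rfl⟩ := Acris.exists_eq_of_add n a
      have h : (Acris.of p C d + (p : Acris p C) ^ n * a') ⊗ₜ[WittVector p B] y =
          (Acris.of p C d ⊗ₜ 1 : T) * (1 ⊗ₜ y) +
            (((p : Acris p C) ^ n) ⊗ₜ 1 : T) * (a' ⊗ₜ y) := by
        rw [Algebra.TensorProduct.tmul_mul_tmul, Algebra.TensorProduct.tmul_mul_tmul, mul_one,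
          one_mul, ← TensorProduct.add_tmul]
      have hpn : mkT (((p : Acris p C) ^ n) ⊗ₜ 1) = 0 := by
        refine Eq.trans ?_ hn
        exact (map_pow (mkT.comp (Algebra.TensorProduct.includeLeftRingHom : Acris p C →+* T))
          (p : Acris p C) n).trans (congrArg (· ^ n) (map_natCast _ p))
      refine ⟨pdHullMap p B B' C d * pdHullBase p B B' C y, ?_⟩
      rw [map_mul, hΨl, hΨr, h, map_add, map_mul, map_mul, hpn, zero_mul, add_zero]
      rfl
  exact bijective_of_rightInverse_mod p n _ Ψ hΦΨ hΨ

end Main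

end

theorem mainTheorem6 (p : ℕ) [Fact p.Prime] (B B' C : Type*) [CommRing B] [CommRing B']
    [CommRing C] [IsFpAlgebra p B] [IsFpAlgebra p B'] [IsFpAlgebra p C] [PerfectRing B p]
    [PerfectRing B' p] [IsSemiperfect p C] [Algebra B B'] [Algebra B C] [Module.Flat B B'] :
    Function.Bijective (Acris.baseChangeMap p B B' C) :=
  PCompletion.lift_bijective p (S := PDHull p (RingHom.ker (wittToBase p (C ⊗[B] B')))) _
    tensorMapMod_bijective
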